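/- Let $m\ge 0$, $t>0$ and $H_S(p)=\sqrt{m^2+p^2}-m$. The Salpeter propagator is $$G(x,t)=\lim_{\eta\to0^+}\frac1{2\pi}\int_{-\infty}^{\infty}e^{-iH_S(p)(t-i\eta)+ipx}\,dp\qquad(x\in\mathbb R,\ x\ne\pm t).$$ For $0<\epsilon<t$ let $C_\epsilon$ be the real axis, traversed from left to right, in which the interval $(-t-\epsilon,-t+\epsilon)$ is replaced by the semicircle of radius $\epsilon$ below $-t$ (namely $-t+\epsilon e^{i\theta}$, $\theta$ from $\pi$ to $2\pi$) and $(t-\epsilon,t+\epsilon)$ by the semicircle of radius $\epsilon$ above $t$ (namely $t+\epsilon e^{i\theta}$, $\theta$ from $\pi$ to $0$). Then: (i) The limit defining $G(x,t)$ exists for all real $x\neq\pm t$, and $G(\cdot,t)$ has an analytic continuation $G(z,t)$ to a neighbourhood of the set $S_t=\bigcup_{0<\epsilon<t}C_\epsilon$, whose values on $S_t$ are unique. (ii) Let $\psi_0:\mathbb R\to\mathbb C$ be continuous with compact support, extended to a Borel function $\psi_0:\mathbb C\to\mathbb C$ that is continuous at every real point, and let $x\in\mathbb R$. Put $$\int_C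 G(z,t)\psi_0(x-z)\,dz=\lim_{\epsilon\to0^+}\int_{C_\epsilon}G(z,t)\psi_0(x-z)\,dz,$$ $$PV\!\int_{-\infty}^\infty G(x',t)\psi_0(x-x')\,dx'=\lim_{\epsilon\to0^+}\int_{|x'-t|\ge\epsilon,\ |x'+t|\ge\epsilon}G(x',t)\psi_0(x-x')\,dx'.$$ One of these two limits exists if and only if the other does, and then $$\int_C G(z,t)\psi_0(x-z)\,dz=PV\!\int_{-\infty}^{\infty}G(x',t)\psi_0(x-x')\,dx'+\tfrac12\psi_0(x-t)\,e^{imt}+\tfrac12\psi_0(x+t)\,e^{imt};$$ for $m=0$ the factor $e^{imt}$ is $1$. (iii) If moreover $\psi_0|_{\mathbb R}$ satisfies a Hölder condition at the points $x-t$ and $x+t$, that is, $\psi_0(y)-\psi_0(x\mp t)=O(|y-(x\mp t)|^{\alpha})$ as $y\to x\mp t$, $y \in \mathbb R$, for some $\alpha>0$, then both limits exist. -/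

import Mathlib

open Filter Topology MeasureTheory

noncomputable section

namespace Salpeter

/-- The Salpeter Hamiltonian of a free particle of mass `m` (units `ħ = c = 1`). -/
def hamiltonian (m p : ℝ) : ℝ := √(m ^ 2 + p ^ 2) - m

/-- The momentum integral `(1/2π) ∫ exp(-i H(p) τ + i p x) dp` at the complex time `τ = t - iη`.
It converges absolutely for `η > 0`; the propagator is its limit as `η → 0⁺`. -/
def regularizedPropagator (m t η x : ℝ) : ℂ :=
  1 / (2 * Real.pi) * ∫ p : ℝ, Complex.exp
    (-Complex.I * (hamiltonian m p : ℂ) * ((t : ℂ) - Complex.I * (η : ℂ))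
      + Complex.I * (p : ℂ) * (x : ℂ))

/-- `G` is the value at `(x, t)` of the propagator
`(1/2π) ∫ exp(-i H(p) (t - i0⁺) + i p x) dp`. -/
def IsPropagatorValue (m t x : ℝ) (G : ℂ) : Prop :=
  Tendsto (fun η : ℝ => regularizedPropagator m t η x) (𝓝[>] 0) (𝓝 G)

/-- The points swept by the contours `C_ε`, `0 < ε < t`: the real axis without the light-cone
points `±t`, the punctured lower half-disc at `-t` and the punctured upper half-disc at `t`. -/
def contourRegion (t : ℝ) : Set ℂ :=
  {z | z ≠ (t : ℂ) ∧ z ≠ -(t : ℂ) ∧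
    (z.im = 0 ∨ (0 < z.im ∧ ‖z - (t : ℂ)‖ < t) ∨ (z.im < 0 ∧ ‖z + (t : ℂ)‖ < t))}

/-- `G` is the analytic continuation of the propagator at time `t` from the real axis without
`±t` along the contours `C_ε` (analytic in a neighbourhood of each of their points). -/
structure IsPropagatorContinuation (m t : ℝ) (G : ℂ → ℂ) : Prop where
  analytic : AnalyticOnNhd ℂ G (contourRegion t)
  real_values : ∀ x : ℝ, x ≠ t → x ≠ -t → IsPropagatorValue m t x (G x)

/-- `Ψ` is an extension of the wave function `ψ₀` to complex arguments, continuous (as a function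
on `ℂ`) at every real point. -/
structure IsComplexExtension (ψ₀ : ℝ → ℂ) (Ψ : ℂ → ℂ) : Prop where
  measurable : Measurable Ψ
  extends_real : ∀ y : ℝ, Ψ y = ψ₀ y
  continuousAt_real : ∀ y : ℝ, ContinuousAt Ψ (y : ℂ)

/-- The real axis with the `ε`-neighbourhoods of `±t` removed. -/
def offPoles (t ε : ℝ) : Set ℝ := {y | ε ≤ |y - t| ∧ ε ≤ |y + t|}

/-- The principal value `PV ∫ f(y) dy` with singular points `±t` exists and equals `L`. -/
def HasPrincipalValue (t : ℝ) (f : ℝ → ℂ) (L : ℂ) : Prop :=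
  Tendsto (fun ε : ℝ => ∫ y in offPoles t ε, f y) (𝓝[>] 0) (𝓝 L)

/-- Integral over the semicircle `-t + ε e^{iθ}`, `θ` from `π` to `2π`, which passes below `-t`
from left to right. -/
def lowerArcIntegral (t ε : ℝ) (f : ℂ → ℂ) : ℂ :=
  ∫ θ in Real.pi..(2 * Real.pi),
    f (-(t : ℂ) + ε * Complex.exp (θ * Complex.I)) *
      (Complex.I * ε * Complex.exp (θ * Complex.I))

/-- Integral over the semicircle `t + ε e^{iθ}`, `θ` from `π` to `0`, which passes above `t`
from left to right. -/
def upperArcIntegral (t ε : ℝ) (f : ℂ → ℂ) : ℂ :=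
  ∫ θ in Real.pi..0,
    f ((t : ℂ) + ε * Complex.exp (θ * Complex.I)) *
      (Complex.I * ε * Complex.exp (θ * Complex.I))

/-- Integral over `C_ε`: the real axis from `-∞` to `∞`, indented by the two semicircles. -/
def indentedContourIntegral (t ε : ℝ) (f : ℂ → ℂ) : ℂ :=
  (∫ y in offPoles t ε, f (y : ℂ)) + lowerArcIntegral t ε f + upperArcIntegral t ε f

/-- The integral of `f` along the contour `C`, the limit of `C_ε` as the radius `ε` of the
indentations tends to `0`, exists and equals `L`. -/
def HasContourIntegral (t : ℝ) (f : ℂ → ℂ) (L : ℂ) : Prop :=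
  Tendsto (fun ε : ℝ => indentedContourIntegral t ε f) (𝓝[>] 0) (𝓝 L)

end Salpeter

end

noncomputable section

namespace Salpeter

/-! For p > 0 the integrand is exp(imτ) times exp(-i h(p) τ) exp(i p w), where w = x - τ and h(p) =
√(m² + p²) - p. In the sector |Im p| ≤ Re p the excess h is holomorphic and bounded by m, so decay
is governed by exp(ipw) alone: along the direction 1 + σi its rate is Im w + σ Re w. Turning the ray
to σ = 1 or σ = -1 makes the integral converge for every w off the cone |Re w| ≤ -Im w, and
uniformly as η → 0⁺ when x ≠ t. Where both rotations converge, Im w > 0 and both equal the integral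
over the real ray (`rayIntegral_eq_rayIntegral_zero`). They glue to a function F analytic off the
cone, and since negative momenta amount to x ↦ -x, G(z) = e^{imt}/(2π) · (F(z - t) + F(-z - t)).

Replacing h by 0 leaves ∫ exp(ipw) dp = i/w. The error is O(|w|^{-1/2}) in the closed upper
half-plane, because |h| ≤ m^{3/2} (Re p)^{-1/2} (`norm_rayIntegral_sub_le`). So G has the pole part
i e^{imt}/(2π(z - t)) at t, up to an integrable term. The clockwise half-circle contributes -πi
times this coefficient, which is e^{imt}/2, and evenness of G gives the same at -t. The arcs
converge without further conditions, so the contour integral and the principal value exist together.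

Under the Hölder condition, subtracting poles cut off symmetrically leaves an integrable function,
while the cut-off poles integrate to 0 by oddness (`exists_hasPrincipalValue`). -/

/-! ### The energy excess in the right half-plane -/

/-- The holomorphic function `√(m² + p²) - p`, by which the energy exceeds that of a massless
particle with momentum `p`. -/
def energyExcess (m : ℝ) (p : ℂ) : ℂ := ((m : ℂ) ^ 2 + p ^ 2) ^ (2⁻¹ : ℂ) - p

lemma massShell_mem_slitPlane (m : ℝ) {p : ℂ} (hp : 0 < p.re) :
    (m : ℂ) ^ 2 + p ^ 2 ∈ Complex.slitPlane := by
  rw [Complex.mem_slitPlane_iff]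
  have hre : ((m : ℂ) ^ 2 + p ^ 2).re = m ^ 2 + (p.re ^ 2 - p.im ^ 2) := by
    simp [pow_two, Complex.mul_re]
  have him : ((m : ℂ) ^ 2 + p ^ 2).im = 2 * (p.re * p.im) := by
    simp [pow_two, Complex.mul_im]; ring
  rw [hre, him]
  by_cases h : p.im = 0
  · left
    rw [h]
    have := pow_pos hp 2
    nlinarith [sq_nonneg m]
  · right
    positivity

lemma differentiableAt_energyExcess (m : ℝ) {p : ℂ} (hp : 0 < p.re) :
    DifferentiableAt ℂ (energyExcess m) p := by
  unfold energyExcess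
  refine DifferentiableAt.sub ?_ differentiableAt_id
  refine DifferentiableAt.cpow (by fun_prop) (by fun_prop) (massShell_mem_slitPlane m hp)

/-- Rationalisation: in the sector |Im p| ≤ Re p the second factor has real part at least m + Re p,
so both bounds on the excess follow from this one product. -/
lemma energyExcess_mul (m : ℝ) (p : ℂ) :
    energyExcess m p * (((m : ℂ) ^ 2 + p ^ 2) ^ (2⁻¹ : ℂ) + p) = (m : ℂ) ^ 2 := by
  have h : (((m : ℂ) ^ 2 + p ^ 2) ^ (2⁻¹ : ℂ)) ^ 2 = (m : ℂ) ^ 2 + p ^ 2 := by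
    simp
  unfold energyExcess
  linear_combination h

lemma energyExcess_ofReal (m : ℝ) (p : ℝ) :
    energyExcess m p = (√(m ^ 2 + p ^ 2) - p : ℝ) := by
  unfold energyExcess
  have : ((m : ℂ) ^ 2 + (p : ℂ) ^ 2) = ((m ^ 2 + p ^ 2 : ℝ) : ℂ) := by push_cast; rfl
  rw [this, show (2⁻¹ : ℂ) = ((2⁻¹ : ℝ) : ℂ) by push_cast; rfl,
    ← Complex.ofReal_cpow (by positivity), Real.sqrt_eq_rpow]
  push_cast
  norm_num

lemma le_re_cpow_inv_two {m : ℝ} {q : ℂ} (hq : m ^ 2 ≤ q.re) :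
    m ≤ (q ^ (2⁻¹ : ℂ)).re := by
  rw [Complex.cpow_inv_two_re]
  apply Real.le_sqrt_of_sq_le
  have := Complex.re_le_norm q
  linarith

/-- In the sector `|Im p| ≤ Re p` the energy excess is at most `m` and at most `m² / Re p`. -/
lemma norm_energyExcess_le {m : ℝ} (hm : 0 ≤ m) {p : ℂ} (hp : 0 < p.re) (hp' : |p.im| ≤ p.re) :
    ‖energyExcess m p‖ ≤ m ∧ ‖energyExcess m p‖ * p.re ≤ m ^ 2 := by
  set S := ((m : ℂ) ^ 2 + p ^ 2) ^ (2⁻¹ : ℂ) with hS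
  have hre : ((m : ℂ) ^ 2 + p ^ 2).re = m ^ 2 + (p.re ^ 2 - p.im ^ 2) := by
    simp [pow_two, Complex.mul_re]
  have hSm : m ≤ S.re := by
    apply le_re_cpow_inv_two
    rw [hre]
    have := sq_le_sq' (by linarith [neg_abs_le p.im]) (le_of_abs_le hp')
    linarith
  have hn : ‖energyExcess m p‖ * ‖S + p‖ = m ^ 2 := by
    rw [← norm_mul, energyExcess_mul]
    simp
  have hle : S.re + p.re ≤ ‖S + p‖ := by
    rw [← Complex.add_re]; exact Complex.re_le_norm _
  have h0 := norm_nonneg (energyExcess m p)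
  have h2 : ‖energyExcess m p‖ * p.re ≤ m ^ 2 := by
    rw [← hn]; gcongr; linarith
  refine ⟨?_, h2⟩
  -- For m = 0 no factor m can be cancelled, but the second bound already forces the excess to
  -- vanish.
  rcases hm.eq_or_lt with rfl | hm
  · have : ‖energyExcess 0 p‖ * p.re ≤ 0 := by simpa using h2
    nlinarith
  · have : ‖energyExcess m p‖ * m ≤ m * m := by
      rw [← pow_two, ← hn]; gcongr; linarith
    exact le_of_mul_le_mul_right this hm

/-! ### Integrals along rays -/

/-- The integrand of the propagator over positive momenta, as a function of complex momentum `p`,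
time `τ` and distance `w` to the light cone. -/
def waveFactor (m : ℝ) (τ w p : ℂ) : ℂ :=
  Complex.exp (-Complex.I * energyExcess m p * τ + Complex.I * p * w)

lemma differentiableAt_waveFactor (m : ℝ) (τ w : ℂ) {p : ℂ} (hp : 0 < p.re) :
    DifferentiableAt ℂ (waveFactor m τ w) p := by
  unfold waveFactor
  have := differentiableAt_energyExcess m hp
  fun_prop

lemma norm_waveFactor_le {m : ℝ} (hm : 0 ≤ m) (τ w : ℂ) {p : ℂ} (hp : 0 < p.re)
    (hp' : |p.im| ≤ p.re) :
    ‖waveFactor m τ w p‖ ≤ Real.exp (m * ‖τ‖) * Real.exp (-(p * w).im) := by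
  unfold waveFactor
  rw [Complex.norm_exp, ← Real.exp_add, Complex.add_re]
  apply Real.exp_le_exp.2
  apply add_le_add
  · calc _ ≤ ‖-Complex.I * energyExcess m p * τ‖ := Complex.re_le_norm _
      _ = ‖energyExcess m p‖ * ‖τ‖ := by simp
      _ ≤ _ := by gcongr; exact (norm_energyExcess_le hm hp hp').1
  · rw [mul_assoc, Complex.I_mul_re]

/-- The direction `1 + σ i` of a ray of integration. -/
def rayDir (σ : ℝ) : ℂ := 1 + σ * Complex.I

@[simp] lemma rayDir_re (σ : ℝ) : (rayDir σ).re = 1 := by simp [rayDir]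
@[simp] lemma rayDir_im (σ : ℝ) : (rayDir σ).im = σ := by simp [rayDir]

lemma ray_re (σ r : ℝ) : ((r : ℂ) * rayDir σ).re = r := by simp
lemma ray_im (σ r : ℝ) : ((r : ℂ) * rayDir σ).im = r * σ := by simp

lemma ray_mul_im (σ r : ℝ) (w : ℂ) :
    ((r : ℂ) * rayDir σ * w).im = r * (w.im + σ * w.re) := by
  rw [Complex.mul_im, ray_re, ray_im]; ring

lemma norm_waveFactor_ray_le {m : ℝ} (hm : 0 ≤ m) (τ w : ℂ) {σ r : ℝ} (hσ : |σ| ≤ 1)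
    (hr : 0 < r) :
    ‖waveFactor m τ w (r * rayDir σ)‖ ≤
      Real.exp (m * ‖τ‖) * Real.exp (-(w.im + σ * w.re) * r) := by
  refine (norm_waveFactor_le hm τ w (by simpa using hr) ?_).trans_eq ?_
  · rw [ray_re, ray_im, abs_mul, abs_of_pos hr]
    exact mul_le_of_le_one_right hr.le hσ
  · rw [ray_mul_im]; ring_nf

/-- The integral of `waveFactor` over the ray with direction `1 + σ i`. -/
def rayIntegral (m σ : ℝ) (τ w : ℂ) : ℂ :=
  ∫ r in Set.Ioi (0 : ℝ), waveFactor m τ w (r * rayDir σ) * rayDir σ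

lemma continuousOn_waveFactor_ray (m σ : ℝ) (τ w : ℂ) :
    ContinuousOn (fun r : ℝ => waveFactor m τ w (r * rayDir σ)) (Set.Ioi 0) := by
  intro r hr
  have h : ContinuousAt (waveFactor m τ w) (r * rayDir σ) :=
    (differentiableAt_waveFactor m τ w (by simpa using hr)).continuousAt
  exact (h.comp (f := fun r : ℝ => (r : ℂ) * rayDir σ) (by fun_prop)).continuousWithinAt

lemma aestronglyMeasurable_waveFactor_ray (m σ : ℝ) (τ w : ℂ) :
    AEStronglyMeasurable (fun r : ℝ => waveFactor m τ w (r * rayDir σ) * rayDir σ)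
      (volume.restrict (Set.Ioi 0)) :=
  ((continuousOn_waveFactor_ray m σ τ w).mul continuousOn_const).aestronglyMeasurable
    measurableSet_Ioi

lemma integrableOn_waveFactor_ray {m : ℝ} (hm : 0 ≤ m) (τ : ℂ) {w : ℂ} {σ : ℝ} (hσ : |σ| ≤ 1)
    (hw : 0 < w.im + σ * w.re) :
    IntegrableOn (fun r : ℝ => waveFactor m τ w (r * rayDir σ) * rayDir σ) (Set.Ioi 0) := by
  refine Integrable.mono' (((exp_neg_integrableOn_Ioi 0 hw).const_mul
    (Real.exp (m * ‖τ‖))).mul_const ‖rayDir σ‖)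
    (aestronglyMeasurable_waveFactor_ray m σ τ w) ?_
  filter_upwards [ae_restrict_mem measurableSet_Ioi] with r hr
  rw [norm_mul]
  gcongr
  exact norm_waveFactor_ray_le hm τ w hσ hr

/-! ### Rotation of the ray -/

lemma tendsto_integral_Ioc_Ioi_zero {f : ℝ → ℂ} (hf : IntegrableOn f (Set.Ioi 0)) :
    Tendsto (fun n : ℕ => ∫ r in (1 / ((n : ℝ) + 1))..((n : ℝ) + 1), f r) atTop
      (𝓝 (∫ r in Set.Ioi (0 : ℝ), f r)) := by
  have ha : Tendsto (fun n : ℕ => 1 / ((n : ℝ) + 1)) atTop (𝓝 0) :=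
    tendsto_one_div_add_atTop_nhds_zero_nat
  have hb : Tendsto (fun n : ℕ => (n : ℝ) + 1) atTop atTop :=
    tendsto_atTop_add_const_right _ _ tendsto_natCast_atTop_atTop
  have hcov := (aecover_Ioi_of_Ioi (μ := volume) ha).inter
    (aecover_Iic (μ := volume.restrict (Set.Ioi 0)) hb)
  refine (hcov.integral_tendsto_of_countably_generated hf).congr fun n => ?_
  have h1 : 1 / ((n : ℝ) + 1) ≤ (n : ℝ) + 1 := by
    rw [div_le_iff₀ (by positivity)]
    nlinarith [Nat.cast_nonneg (α := ℝ) n]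
  rw [intervalIntegral.integral_of_le h1, Set.Ioi_inter_Iic,
    Measure.restrict_restrict measurableSet_Ioc,
    Set.inter_eq_left.2 (Set.Ioc_subset_Ioi_self.trans
      (Set.Ioi_subset_Ioi (by positivity)))]

/-- Rotation of the ray of integration for a function holomorphic in the right half-plane and
exponentially small in the sector swept out by the ray. -/
lemma integral_ray_eq_of_exp_decay {f : ℂ → ℂ} (hf : DifferentiableOn ℂ f {p | 0 < p.re})
    {σ C δ : ℝ} (hδ : 0 < δ)
    (hb : ∀ r : ℝ, 0 < r → ∀ s ∈ Set.uIcc 0 σ, ‖f (r * rayDir s)‖ ≤ C * Real.exp (-δ * r))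
    (h0 : IntegrableOn (fun r : ℝ => f (r * rayDir 0) * rayDir 0) (Set.Ioi 0))
    (hσ : IntegrableOn (fun r : ℝ => f (r * rayDir σ) * rayDir σ) (Set.Ioi 0)) :
    ∫ r in Set.Ioi (0 : ℝ), f (r * rayDir σ) * rayDir σ =
      ∫ r in Set.Ioi (0 : ℝ), f (r * rayDir 0) * rayDir 0 := by
  have key : ∀ a b : ℝ, 0 < a → a ≤ b →
      ‖(∫ r in a..b, f (r * rayDir σ) * rayDir σ) - ∫ r in a..b, f (r * rayDir 0) * rayDir 0‖ ≤
        C * Real.exp (-δ * b) * b * |σ| + C * Real.exp (-δ * a) * a * |σ| := by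
    intro a b ha hab
    have hbpos : 0 < b := ha.trans_le hab
    -- The disc of centre M and radius M touches the imaginary axis at 0. For r > 0 it contains r(1
    -- + si) exactly when r(1 + s²) < 2M, so it covers the region between the rays for a ≤ r ≤ b,
    -- and on a disc a primitive exists.
    set M : ℝ := b * (1 + σ ^ 2) with hM
    have hball : ∀ r ∈ Set.Icc a b, ∀ s ∈ Set.uIcc 0 σ,
        (r : ℂ) * rayDir s ∈ Metric.ball (M : ℂ) M := by
      intro r hr s hs
      have hr0 : 0 < r := ha.trans_le hr.1
      have hss : s ^ 2 ≤ σ ^ 2 := by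
        apply sq_le_sq.2
        simpa using Set.abs_sub_left_of_mem_uIcc hs
      have hMpos : 0 < M := by positivity
      rw [Metric.mem_ball, Complex.dist_eq, ← sq_lt_sq₀ (norm_nonneg _) hMpos.le,
        ← Complex.normSq_eq_norm_sq, Complex.normSq_apply, Complex.sub_re, Complex.sub_im, ray_re,
        ray_im, Complex.ofReal_re, Complex.ofReal_im]
      have h1 : r * (1 + s ^ 2) < 2 * M := by
        have : r * (1 + s ^ 2) ≤ M := by
          rw [hM]
          gcongr
          exact hr.2
        linarith
      nlinarith
    have hsub : Metric.ball (M : ℂ) M ⊆ {p : ℂ | 0 < p.re} := by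
      intro p hp
      rw [Metric.mem_ball, Complex.dist_eq] at hp
      have := (Complex.abs_re_le_norm (p - M)).trans_lt hp
      rw [Complex.sub_re, Complex.ofReal_re, abs_lt] at this
      show 0 < p.re
      linarith
    obtain ⟨Φ, hΦ⟩ := (hf.mono hsub).isExactOn_ball
    have hint : ∀ s ∈ Set.uIcc 0 σ, (∫ r in a..b, f (r * rayDir s) * rayDir s) =
        Φ (b * rayDir s) - Φ (a * rayDir s) := by
      intro s hs
      refine intervalIntegral.integral_eq_sub_of_hasDerivAt
        (f := fun r : ℝ => Φ (r * rayDir s)) ?_ ?_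
      · intro r hr
        rw [Set.uIcc_of_le hab] at hr
        have h1 := hΦ _ (hball r hr s hs)
        have h2 : HasDerivAt (fun r : ℝ => (r : ℂ) * rayDir s) (rayDir s) r := by
          simpa using (Complex.ofRealCLM.hasDerivAt (x := r)).mul_const (rayDir s)
        exact h1.comp r h2
      · apply ContinuousOn.intervalIntegrable
        rw [Set.uIcc_of_le hab]
        intro r hr
        have h1 : ContinuousAt f (r * rayDir s) :=
          (hf.mono hsub).continuousOn.continuousAt (Metric.isOpen_ball.mem_nhds (hball r hr s hs))
        have h2 : ContinuousAt (fun r : ℝ => f (r * rayDir s)) r :=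
          h1.comp (f := fun r : ℝ => (r : ℂ) * rayDir s) (by fun_prop)
        exact (h2.mul continuousAt_const).continuousWithinAt
    -- The rays are joined by the vertical segment Re p = r of length r|σ|. Its contribution
    -- vanishes as r → ∞ by decay and as r → 0 by shortness.
    have hseg : ∀ r ∈ Set.Icc a b, ‖Φ (r * rayDir σ) - Φ (r * rayDir 0)‖ ≤
        C * Real.exp (-δ * r) * r * |σ| := by
      intro r hr
      have hr0 : 0 < r := ha.trans_le hr.1
      have := (convex_uIcc (0 : ℝ) σ).norm_image_sub_le_of_norm_hasDerivWithin_le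
        (f := fun s : ℝ => Φ (r * rayDir s))
        (f' := fun s => f (r * rayDir s) * (r * Complex.I))
        (C := C * Real.exp (-δ * r) * r) ?_ ?_ Set.left_mem_uIcc Set.right_mem_uIcc
      · simpa using this
      · intro s hs
        have h1 := hΦ _ (hball r hr s hs)
        have h2 : HasDerivAt (fun s : ℝ => (r : ℂ) * rayDir s) (r * Complex.I) s := by
          have := (((Complex.ofRealCLM.hasDerivAt (x := s)).mul_const Complex.I).const_add
            1).const_mul (r : ℂ)
          simpa [rayDir] using this
        exact (h1.comp s h2).hasDerivWithinAt
      · intro s hs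
        rw [norm_mul, norm_mul, Complex.norm_I, mul_one, Complex.norm_real, Real.norm_eq_abs,
          abs_of_pos hr0]
        gcongr
        exact hb r hr0 s hs
    rw [hint σ Set.right_mem_uIcc, hint 0 Set.left_mem_uIcc]
    calc _ = ‖(Φ (b * rayDir σ) - Φ (b * rayDir 0)) - (Φ (a * rayDir σ) - Φ (a * rayDir 0))‖ := by
            congr 1; ring
      _ ≤ _ := norm_sub_le _ _
      _ ≤ _ := add_le_add (hseg b ⟨hab, le_rfl⟩) (hseg a ⟨le_rfl, hab⟩)
  have ha : Tendsto (fun n : ℕ => 1 / ((n : ℝ) + 1)) atTop (𝓝 0) :=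
    tendsto_one_div_add_atTop_nhds_zero_nat
  have hbt : Tendsto (fun n : ℕ => (n : ℝ) + 1) atTop atTop :=
    tendsto_atTop_add_const_right _ _ tendsto_natCast_atTop_atTop
  have hlim := (tendsto_integral_Ioc_Ioi_zero hσ).sub (tendsto_integral_Ioc_Ioi_zero h0)
  rw [← sub_eq_zero]
  refine tendsto_nhds_unique hlim (squeeze_zero_norm (fun n => key _ _ ?_ ?_) ?_)
  · positivity
  · rw [div_le_iff₀ (by positivity)]
    nlinarith [Nat.cast_nonneg (α := ℝ) n]
  · have hA : Tendsto (fun b : ℝ => C * Real.exp (-δ * b) * b * |σ|) atTop (𝓝 0) := by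
      have h := Real.tendsto_pow_mul_exp_neg_atTop_nhds_zero 1
      have h' := (h.comp (tendsto_id.const_mul_atTop hδ)).const_mul (C * |σ| / δ)
      rw [mul_zero] at h'
      refine h'.congr fun b => ?_
      simp only [Function.comp, id, pow_one, neg_mul]
      field_simp
    have hB : Tendsto (fun a : ℝ => C * Real.exp (-δ * a) * a * |σ|) (𝓝 0) (𝓝 0) := by
      have : Continuous (fun a : ℝ => C * Real.exp (-δ * a) * a * |σ|) := by fun_prop
      simpa using this.tendsto 0
    simpa using (hA.comp hbt).add (hB.comp ha)

lemma rayIntegral_eq_rayIntegral_zero {m : ℝ} (hm : 0 ≤ m) (τ : ℂ) {w : ℂ} {σ : ℝ}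
    (hσ : |σ| ≤ 1) (hw : 0 < w.im) (hw' : 0 < w.im + σ * w.re) :
    rayIntegral m σ τ w = rayIntegral m 0 τ w := by
  -- The rate w.im + s * w.re is affine in s, hence at least the smaller of its values at 0 and σ.
  refine integral_ray_eq_of_exp_decay (f := waveFactor m τ w) (δ := min w.im (w.im + σ * w.re))
    (C := Real.exp (m * ‖τ‖)) (fun p hp => ?_) (lt_min hw hw') (fun r hr s hs => ?_)
    (integrableOn_waveFactor_ray hm τ (by simp) (by simpa using hw))
    (integrableOn_waveFactor_ray hm τ hσ hw')
  · exact (differentiableAt_waveFactor m τ w hp).differentiableWithinAt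
  · have hs1 : |s| ≤ |σ| := by simpa using Set.abs_sub_left_of_mem_uIcc hs
    refine (norm_waveFactor_ray_le hm τ w (hs1.trans hσ) hr).trans ?_
    gcongr
    obtain ⟨h1, h2⟩ | ⟨h1, h2⟩ := Set.mem_uIcc.1 hs
    · rcases le_total 0 w.re with h | h
      · exact (min_le_left _ _).trans (by nlinarith)
      · exact (min_le_right _ _).trans (by nlinarith)
    · rcases le_total 0 w.re with h | h
      · exact (min_le_right _ _).trans (by nlinarith)
      · exact (min_le_left _ _).trans (by nlinarith)

/-! ### Holomorphy, the limit η → 0⁺ and the pole of the ray integral -/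

lemma mul_exp_neg_le {δ : ℝ} (hδ : 0 < δ) (r : ℝ) :
    r * Real.exp (-δ * r) ≤ 2 / δ * Real.exp (-(δ / 2) * r) := by
  have h1 : r ≤ 2 / δ * Real.exp (δ / 2 * r) := by
    have := Real.add_one_le_exp (δ / 2 * r)
    rw [div_mul_eq_mul_div, le_div_iff₀ hδ]
    linarith
  calc r * Real.exp (-δ * r) ≤ 2 / δ * Real.exp (δ / 2 * r) * Real.exp (-δ * r) := by gcongr
    _ = _ := by rw [mul_assoc, ← Real.exp_add]; ring_nf

lemma isOpen_rayDomain (σ c : ℝ) : IsOpen {w : ℂ | c < w.im + σ * w.re} :=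
  isOpen_lt continuous_const (by fun_prop)

/-- Differentiation under the integral sign brings down a factor r, which is absorbed by giving up
half of the decay rate δ available near the chosen point. -/
lemma differentiableOn_rayIntegral {m : ℝ} (hm : 0 ≤ m) (τ : ℂ) {σ : ℝ} (hσ : |σ| ≤ 1) :
    DifferentiableOn ℂ (rayIntegral m σ τ) {w | 0 < w.im + σ * w.re} := by
  intro w₀ hw₀
  have hw₀' : 0 < w₀.im + σ * w₀.re := hw₀
  set δ := (w₀.im + σ * w₀.re) / 2 with hδdef
  have hδ : 0 < δ := by positivity
  have hs : {w : ℂ | δ < w.im + σ * w.re} ∈ 𝓝 w₀ :=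
    (isOpen_rayDomain σ δ).mem_nhds (show δ < _ by linarith)
  have := hasDerivAt_integral_of_dominated_loc_of_deriv_le (μ := volume.restrict (Set.Ioi 0))
    (F := fun w (r : ℝ) => waveFactor m τ w (r * rayDir σ) * rayDir σ)
    (F' := fun w (r : ℝ) => waveFactor m τ w (r * rayDir σ) * (Complex.I * (r * rayDir σ)) *
      rayDir σ)
    (bound := fun r => Real.exp (m * ‖τ‖) * (2 / δ * Real.exp (-(δ / 2) * r)) * ‖rayDir σ‖ ^ 2)
    hs (Eventually.of_forall fun w => aestronglyMeasurable_waveFactor_ray m σ τ w)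
    (integrableOn_waveFactor_ray hm τ hσ hw₀') ?_ ?_ ?_ ?_
  · exact this.2.differentiableAt.differentiableWithinAt
  · refine ContinuousOn.aestronglyMeasurable ?_ measurableSet_Ioi
    exact ((continuousOn_waveFactor_ray m σ τ w₀).mul (by fun_prop)).mul continuousOn_const
  · filter_upwards [ae_restrict_mem measurableSet_Ioi] with r hr w hw
    have hr0 : 0 < r := hr
    have hw' : δ < w.im + σ * w.re := hw
    rw [norm_mul, norm_mul, norm_mul, norm_mul, Complex.norm_I, Complex.norm_real,
      Real.norm_eq_abs, abs_of_pos hr0]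
    calc _ ≤ (Real.exp (m * ‖τ‖) * Real.exp (-δ * r)) * (1 * (r * ‖rayDir σ‖)) * ‖rayDir σ‖ := by
          gcongr
          refine (norm_waveFactor_ray_le hm τ w hσ hr).trans ?_
          gcongr
      _ = Real.exp (m * ‖τ‖) * (r * Real.exp (-δ * r)) * ‖rayDir σ‖ ^ 2 := by ring
      _ ≤ _ := mul_le_mul_of_nonneg_right
          (mul_le_mul_of_nonneg_left (mul_exp_neg_le hδ r) (Real.exp_pos _).le) (by positivity)
  · exact (((exp_neg_integrableOn_Ioi 0 (half_pos hδ)).const_mul _).const_mul _).mul_const _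
  · refine Eventually.of_forall fun r w _ => ?_
    unfold waveFactor
    have h : HasDerivAt (fun w : ℂ => -Complex.I * energyExcess m (r * rayDir σ) * τ +
        Complex.I * (r * rayDir σ) * w) (Complex.I * (r * rayDir σ)) w := by
      simpa using ((hasDerivAt_id w).const_mul (Complex.I * (r * rayDir σ))).const_add
        (-Complex.I * energyExcess m (r * rayDir σ) * τ)
    exact h.cexp.mul_const _

/-- The rotated ray is what permits dominated convergence: its rate η + σ(x - t) stays above σ(x -
t) > 0, whereas on the real ray the rate is only η. -/
lemma tendsto_rayIntegral {m : ℝ} (hm : 0 ≤ m) (t : ℝ) {x σ : ℝ} (hσ : |σ| ≤ 1)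
    (hx : 0 < σ * (x - t)) :
    Tendsto (fun η : ℝ => rayIntegral m σ (t - Complex.I * η) (x - (t - Complex.I * η)))
      (𝓝[>] 0) (𝓝 (rayIntegral m σ t (x - t))) := by
  refine tendsto_integral_filter_of_dominated_convergence
    (fun r => Real.exp (m * (|t| + 1)) * Real.exp (-(σ * (x - t)) * r) * ‖rayDir σ‖)
    (Eventually.of_forall fun η => aestronglyMeasurable_waveFactor_ray m σ _ _) ?_ ?_ ?_
  · filter_upwards [Ioo_mem_nhdsGT one_pos] with η hη
    filter_upwards [ae_restrict_mem measurableSet_Ioi] with r hr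
    have hr0 : 0 < r := hr
    rw [norm_mul]
    gcongr
    refine (norm_waveFactor_ray_le hm _ _ hσ hr).trans ?_
    have h1 : ‖(t : ℂ) - Complex.I * η‖ ≤ |t| + 1 := by
      refine (norm_sub_le _ _).trans ?_
      rw [norm_mul, Complex.norm_I, one_mul, Complex.norm_real, Complex.norm_real,
        Real.norm_eq_abs, Real.norm_eq_abs, abs_of_pos hη.1]
      linarith [hη.2]
    have h2 : ((x : ℂ) - (t - Complex.I * η)).im + σ * ((x : ℂ) - (t - Complex.I * η)).re =
        η + σ * (x - t) := by simp
    rw [h2]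
    gcongr
    linarith [hη.1]
  · exact ((exp_neg_integrableOn_Ioi 0 hx).const_mul _).mul_const _
  · refine Eventually.of_forall fun r => ?_
    have : Continuous fun η : ℝ => waveFactor m (t - Complex.I * η) (x - (t - Complex.I * η))
        (r * rayDir σ) * rayDir σ := by
      unfold waveFactor; fun_prop
    have h := (this.tendsto 0).mono_left (nhdsWithin_le_nhds (s := Set.Ioi 0))
    simpa using h

lemma norm_exp_sub_one_le_mul_exp (z : ℂ) : ‖Complex.exp z - 1‖ ≤ ‖z‖ * Real.exp ‖z‖ := by
  simpa using Complex.norm_exp_sub_sum_le_norm_mul_exp z 1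

/-- Up to an integrable singularity, `rayIntegral` has the simple pole `i / w`. -/
lemma norm_rayIntegral_sub_le {m : ℝ} (hm : 0 ≤ m) (τ : ℂ) {σ : ℝ} (hσ : |σ| ≤ 1) :
    ∃ K : ℝ, 0 ≤ K ∧ ∀ w : ℂ, 0 < w.im + σ * w.re →
      ‖rayIntegral m σ τ w - Complex.I / w‖ ≤ K * (w.im + σ * w.re) ^ (-(1 / 2) : ℝ) := by
  set A : ℝ := √(m ^ 3) * ‖τ‖ * Real.exp (m * ‖τ‖) * ‖rayDir σ‖ with hA
  have hA0 : 0 ≤ A := by positivity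
  have hG : 0 < Real.Gamma (1 / 2) := Real.Gamma_pos_of_pos (by norm_num)
  refine ⟨A * Real.Gamma (1 / 2), by positivity, fun w hw => ?_⟩
  set δ := w.im + σ * w.re with hδ
  have hw0 : w ≠ 0 := by
    rintro rfl
    simp [hδ] at hw
  have hdir : rayDir σ ≠ 0 := fun h => by simpa using congrArg Complex.re h
  have hre : (Complex.I * rayDir σ * w).re = -δ := by
    simp [hδ, Complex.mul_re, Complex.mul_im]
    ring
  -- The singular part is the ray integral with the excess set to 0.
  have hpole : ∫ r in Set.Ioi (0 : ℝ), Complex.exp (Complex.I * rayDir σ * w * r) * rayDir σ =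
      Complex.I / w := by
    rw [integral_mul_const, integral_exp_mul_complex_Ioi (by rw [hre]; linarith)]
    simp only [Complex.ofReal_zero, mul_zero, Complex.exp_zero]
    field_simp
    simp
  have hpint : IntegrableOn (fun r : ℝ => Complex.exp (Complex.I * rayDir σ * w * r) * rayDir σ)
      (Set.Ioi 0) :=
    (integrableOn_exp_mul_complex_Ioi (by rw [hre]; linarith) 0).mul_const _
  rw [← hpole, rayIntegral, ← integral_sub (integrableOn_waveFactor_ray hm τ hσ hw) hpint]
  have hbd : IntegrableOn (fun r : ℝ => A * (r ^ ((1 / 2 : ℝ) - 1) * Real.exp (-(δ * r))))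
      (Set.Ioi 0) := by
    have := integrableOn_rpow_mul_exp_neg_mul_rpow (s := (1 / 2 : ℝ) - 1) (p := 1) (b := δ)
      (by norm_num) (by norm_num) hw
    simpa [IntegrableOn] using this.const_mul A
  calc _ ≤ ∫ r in Set.Ioi (0 : ℝ), A * (r ^ ((1 / 2 : ℝ) - 1) * Real.exp (-(δ * r))) := by
        refine norm_integral_le_of_norm_le hbd ?_
        filter_upwards [ae_restrict_mem measurableSet_Ioi] with r hr
        have hr0 : 0 < r := hr
        set h := energyExcess m (r * rayDir σ) with hh
        obtain ⟨e1, e2⟩ := norm_energyExcess_le hm (p := r * rayDir σ) (by simpa using hr0) (by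
          rw [ray_re, ray_im, abs_mul, abs_of_pos hr0]
          exact mul_le_of_le_one_right hr0.le hσ)
        rw [ray_re, ← hh] at e2
        rw [← hh] at e1
        -- Geometric mean of the bounds m and m²/r: integrable at r = 0, and it scales to δ^(-1/2)
        -- after integration against exp(-δr).
        have e3 : ‖h‖ ≤ √(m ^ 3) * r ^ ((1 / 2 : ℝ) - 1) := by
          have : r ^ ((1 / 2 : ℝ) - 1) = √(r⁻¹) := by
            rw [Real.sqrt_eq_rpow, Real.inv_rpow hr0.le, ← Real.rpow_neg hr0.le]
            norm_num
          rw [this, ← Real.sqrt_mul (by positivity)]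
          apply Real.le_sqrt_of_sq_le
          rw [← div_eq_mul_inv, le_div_iff₀ hr0]
          nlinarith [norm_nonneg h]
        have e4 : waveFactor m τ w (r * rayDir σ) * rayDir σ -
            Complex.exp (Complex.I * rayDir σ * w * r) * rayDir σ =
            (Complex.exp (-Complex.I * h * τ) - 1) *
              Complex.exp (Complex.I * rayDir σ * w * r) * rayDir σ := by
          rw [waveFactor, Complex.exp_add, ← hh,
            show Complex.I * (↑r * rayDir σ) * w = Complex.I * rayDir σ * w * r by ring]
          ring
        have e5 : ‖Complex.exp (-Complex.I * h * τ) - 1‖ ≤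
            √(m ^ 3) * r ^ ((1 / 2 : ℝ) - 1) * ‖τ‖ * Real.exp (m * ‖τ‖) := by
          have hn : ‖-Complex.I * h * τ‖ = ‖h‖ * ‖τ‖ := by simp
          refine (norm_exp_sub_one_le_mul_exp _).trans ?_
          rw [hn]
          gcongr
        have e6 : ‖Complex.exp (Complex.I * rayDir σ * w * r)‖ = Real.exp (-(δ * r)) := by
          rw [Complex.norm_exp, Complex.re_mul_ofReal, hre]
          ring_nf
        rw [e4, norm_mul, norm_mul, e6]
        calc _ ≤ √(m ^ 3) * r ^ ((1 / 2 : ℝ) - 1) * ‖τ‖ * Real.exp (m * ‖τ‖) *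
              Real.exp (-(δ * r)) * ‖rayDir σ‖ := by gcongr
          _ = _ := by rw [hA]; ring
    _ = _ := by
        rw [integral_const_mul, Real.integral_rpow_mul_exp_neg_mul_Ioi (by norm_num) hw,
          one_div δ, Real.inv_rpow hw.le, ← Real.rpow_neg hw.le]
        ring

/-! ### Continuation around the light cone -/

/-- The contribution of the positive momenta to the propagator, continued analytically in the
distance `w` to the light cone by rotating the ray of integration. -/
def halfLinePropagator (m t : ℝ) (w : ℂ) : ℂ :=
  if 0 < w.im + 1 * w.re then rayIntegral m 1 t w else rayIntegral m (-1) t w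

lemma halfLinePropagator_of_pos {m t : ℝ} {w : ℂ} (hw : 0 < w.im + 1 * w.re) :
    halfLinePropagator m t w = rayIntegral m 1 t w := if_pos hw

lemma halfLinePropagator_of_neg {m t : ℝ} (hm : 0 ≤ m) {w : ℂ} (hw : 0 < w.im + (-1) * w.re) :
    halfLinePropagator m t w = rayIntegral m (-1) t w := by
  unfold halfLinePropagator
  split_ifs with h
  · have him : 0 < w.im := by linarith
    rw [rayIntegral_eq_rayIntegral_zero hm _ (by simp) him h,
      rayIntegral_eq_rayIntegral_zero hm _ (by simp) him hw]
  · rfl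

lemma analyticAt_halfLinePropagator {m : ℝ} (hm : 0 ≤ m) (t : ℝ) {w : ℂ}
    (hw : 0 < w.im + 1 * w.re ∨ 0 < w.im + (-1) * w.re) :
    AnalyticAt ℂ (halfLinePropagator m t) w := by
  rcases hw with hw | hw
  · have hU := isOpen_rayDomain 1 0
    refine ((differentiableOn_rayIntegral hm t (σ := 1) (by simp)).analyticAt
      (hU.mem_nhds hw)).congr ?_
    filter_upwards [hU.mem_nhds hw] with z hz
    exact (halfLinePropagator_of_pos hz).symm
  · have hU := isOpen_rayDomain (-1) 0
    refine ((differentiableOn_rayIntegral hm t (σ := -1) (by simp)).analyticAt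
      (hU.mem_nhds hw)).congr ?_
    filter_upwards [hU.mem_nhds hw] with z hz
    exact (halfLinePropagator_of_neg hm hz).symm

/-- Taking σ with the sign of Re w makes the rate Im w + |Re w|, which is at least ‖w‖ in the closed
upper half-plane. -/
lemma norm_halfLinePropagator_sub_le {m : ℝ} (hm : 0 ≤ m) (t : ℝ) :
    ∃ K : ℝ, 0 ≤ K ∧ ∀ w : ℂ, w ≠ 0 → 0 ≤ w.im →
      ‖halfLinePropagator m t w - Complex.I / w‖ ≤ K * ‖w‖ ^ (-(1 / 2) : ℝ) := by
  obtain ⟨K₁, hK₁, h₁⟩ := norm_rayIntegral_sub_le hm t (σ := 1) (by simp)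
  obtain ⟨K₂, hK₂, h₂⟩ := norm_rayIntegral_sub_le hm t (σ := -1) (by simp)
  refine ⟨K₁ + K₂, by positivity, fun w hw him => ?_⟩
  have hn : 0 < ‖w‖ := norm_pos_iff.2 hw
  have hle := Complex.norm_le_abs_re_add_abs_im w
  rw [abs_of_nonneg him] at hle
  rcases le_total 0 w.re with h | h
  · rw [abs_of_nonneg h] at hle
    have hd : ‖w‖ ≤ w.im + 1 * w.re := by linarith
    rw [halfLinePropagator_of_pos (hn.trans_le hd)]
    calc _ ≤ K₁ * (w.im + 1 * w.re) ^ (-(1 / 2) : ℝ) := h₁ w (hn.trans_le hd)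
      _ ≤ (K₁ + K₂) * ‖w‖ ^ (-(1 / 2) : ℝ) :=
        mul_le_mul (by linarith) (Real.rpow_le_rpow_of_nonpos hn hd (by norm_num))
          (Real.rpow_nonneg (hn.le.trans hd) _) (by positivity)
  · rw [abs_of_nonpos h] at hle
    have hd : ‖w‖ ≤ w.im + (-1) * w.re := by linarith
    rw [halfLinePropagator_of_neg hm (hn.trans_le hd)]
    calc _ ≤ K₂ * (w.im + (-1) * w.re) ^ (-(1 / 2) : ℝ) := h₂ w (hn.trans_le hd)
      _ ≤ (K₁ + K₂) * ‖w‖ ^ (-(1 / 2) : ℝ) :=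
        mul_le_mul (by linarith) (Real.rpow_le_rpow_of_nonpos hn hd (by norm_num))
          (Real.rpow_nonneg (hn.le.trans hd) _) (by positivity)

/-! ### The propagator and its continuation -/

/-- The integrand of the regularized propagator. -/
def planeWave (m : ℝ) (τ : ℂ) (x p : ℝ) : ℂ :=
  Complex.exp (-Complex.I * (hamiltonian m p : ℂ) * τ + Complex.I * (p : ℂ) * (x : ℂ))

lemma planeWave_neg (m : ℝ) (τ : ℂ) (x p : ℝ) :
    planeWave m τ x (-p) = planeWave m τ (-x) p := by
  simp [planeWave, hamiltonian]

lemma planeWave_eq_waveFactor (m : ℝ) (τ : ℂ) (x p : ℝ) :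
    planeWave m τ x p =
      Complex.exp (Complex.I * m * τ) * (waveFactor m τ (x - τ) (p * rayDir 0) * rayDir 0) := by
  have h0 : rayDir 0 = 1 := by simp [rayDir]
  rw [h0, mul_one, mul_one, waveFactor, planeWave, energyExcess_ofReal, hamiltonian,
    ← Complex.exp_add]
  congr 1
  push_cast
  ring

lemma im_sub_time (t η x σ : ℝ) :
    ((x : ℂ) - (t - Complex.I * η)).im + σ * ((x : ℂ) - (t - Complex.I * η)).re =
      η + σ * (x - t) := by simp

lemma integrableOn_planeWave {m : ℝ} (hm : 0 ≤ m) (t x : ℝ) {η : ℝ} (hη : 0 < η) :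
    IntegrableOn (planeWave m (t - Complex.I * η) x) (Set.Ioi 0) := by
  have := (integrableOn_waveFactor_ray hm (t - Complex.I * η) (σ := 0)
    (w := x - (t - Complex.I * η)) (by simp) (by rw [im_sub_time]; simpa using hη)).const_mul
    (Complex.exp (Complex.I * m * (t - Complex.I * η)))
  refine this.congr (Eventually.of_forall fun p => ?_)
  exact (planeWave_eq_waveFactor _ _ _ _).symm

/-- The Hamiltonian is even, so reflecting p turns the negative half-line into the positive one with
x replaced by -x. -/
lemma regularizedPropagator_eq {m : ℝ} (hm : 0 ≤ m) (t x : ℝ) {η : ℝ} (hη : 0 < η) :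
    regularizedPropagator m t η x = 1 / (2 * Real.pi) *
      ((∫ p in Set.Ioi (0 : ℝ), planeWave m (t - Complex.I * η) x p) +
        ∫ p in Set.Ioi (0 : ℝ), planeWave m (t - Complex.I * η) (-x) p) := by
  have hpos := integrableOn_planeWave hm t x hη
  have hneg : IntegrableOn (planeWave m (t - Complex.I * η) x) (Set.Iic 0) := by
    rw [integrableOn_Iic_iff_integrableOn_Iio]
    have h := integrableOn_planeWave hm t (-x) hη
    rw [← neg_zero] at h
    refine h.comp_neg_Iio.congr_fun (fun p _ => ?_) measurableSet_Iio
    simp only [planeWave_neg, neg_neg]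
  rw [regularizedPropagator]
  congr 1
  change ∫ p, planeWave m (t - Complex.I * η) x p = _
  rw [← intervalIntegral.integral_Iic_add_Ioi hneg hpos, add_comm]
  congr 1
  have := integral_comp_neg_Ioi (0 : ℝ) (planeWave m (t - Complex.I * η) x)
  rw [neg_zero] at this
  rw [← this]
  exact setIntegral_congr_fun measurableSet_Ioi fun p _ => planeWave_neg _ _ _ _

lemma tendsto_integral_planeWave {m : ℝ} (hm : 0 ≤ m) (t : ℝ) {x : ℝ} (hx : x ≠ t) :
    Tendsto (fun η : ℝ => ∫ p in Set.Ioi (0 : ℝ), planeWave m (t - Complex.I * η) x p) (𝓝[>] 0)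
      (𝓝 (Complex.exp (Complex.I * m * t) * halfLinePropagator m t (x - t))) := by
  have key : ∀ σ : ℝ, |σ| ≤ 1 → 0 < σ * (x - t) →
      Tendsto (fun η : ℝ => ∫ p in Set.Ioi (0 : ℝ), planeWave m (t - Complex.I * η) x p) (𝓝[>] 0)
        (𝓝 (Complex.exp (Complex.I * m * t) * rayIntegral m σ t (x - t))) := by
    intro σ hσ hσx
    have h1 : Tendsto (fun η : ℝ => Complex.exp (Complex.I * m * (t - Complex.I * η))) (𝓝[>] 0)
        (𝓝 (Complex.exp (Complex.I * m * t))) := by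
      have : Continuous (fun η : ℝ => Complex.exp (Complex.I * m * (t - Complex.I * η))) := by
        fun_prop
      have h := (this.tendsto 0).mono_left (nhdsWithin_le_nhds (s := Set.Ioi 0))
      simpa using h
    refine (h1.mul (tendsto_rayIntegral hm t hσ hσx)).congr' ?_
    filter_upwards [self_mem_nhdsWithin] with η hη
    have hη0 : 0 < η := hη
    simp only [planeWave_eq_waveFactor]
    -- For η > 0 the point x - τ has imaginary part η, so the real ray may be rotated before η tends
    -- to 0.
    rw [integral_const_mul, rayIntegral_eq_rayIntegral_zero hm _ hσ]
    · rfl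
    · simpa using hη0
    · rw [im_sub_time]; positivity
  rcases lt_or_gt_of_ne hx with h | h
  · rw [halfLinePropagator_of_neg hm (by simpa using h)]
    exact key (-1) (by simp) (by linarith)
  · rw [halfLinePropagator_of_pos (by simpa using h)]
    exact key 1 (by simp) (by linarith)

/-- The analytic continuation of the propagator. -/
def propagator (m t : ℝ) (z : ℂ) : ℂ :=
  1 / (2 * Real.pi) * (Complex.exp (Complex.I * m * t) * halfLinePropagator m t (z - t) +
    Complex.exp (Complex.I * m * t) * halfLinePropagator m t (-z - t))

lemma propagator_neg (m t : ℝ) (z : ℂ) : propagator m t (-z) = propagator m t z := by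
  simp only [propagator, neg_neg]
  ring

lemma neg_mem_contourRegion {t : ℝ} {z : ℂ} (hz : z ∈ contourRegion t) :
    -z ∈ contourRegion t := by
  obtain ⟨h1, h2, h3⟩ := hz
  refine ⟨fun h => h2 (by rw [← h, neg_neg]), fun h => h1 (neg_injective h), ?_⟩
  have e1 : ‖-z - (t : ℂ)‖ = ‖z + t‖ := by rw [← norm_neg]; congr 1; ring
  have e2 : ‖-z + (t : ℂ)‖ = ‖z - t‖ := by rw [← norm_neg]; congr 1; ring
  rw [e1, e2, Complex.neg_im, neg_eq_zero, neg_pos, neg_lt_zero]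
  tauto

/-- The delicate case is the lower half-disc at -t, seen from t: its radius t gives Re z < 0 and Im
z > -t, hence Im z - Re z + t > 0. -/
lemma sub_mem_cone_of_mem_contourRegion {t : ℝ} {z : ℂ} (hz : z ∈ contourRegion t) :
    0 < (z - t).im + 1 * (z - t).re ∨ 0 < (z - t).im + (-1) * (z - t).re := by
  obtain ⟨h1, -, h3⟩ := hz
  simp only [Complex.sub_im, Complex.sub_re, Complex.ofReal_re, Complex.ofReal_im]
  rcases h3 with h | ⟨h, -⟩ | ⟨h, h'⟩
  · have : z.re ≠ t := fun h' => h1 (Complex.ext (by simpa using h') (by simpa using h))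
    rcases lt_or_gt_of_ne this with h' | h'
    · right; linarith
    · left; linarith
  · by_contra hcon
    rw [not_or] at hcon
    linarith [hcon.1, hcon.2]
  · right
    have hr := (Complex.abs_re_le_norm (z + t)).trans_lt h'
    have hi := (Complex.abs_im_le_norm (z + t)).trans_lt h'
    simp only [Complex.add_re, Complex.add_im, Complex.ofReal_re, Complex.ofReal_im,
      add_zero] at hr hi
    rw [abs_lt] at hr hi
    linarith [hr.2, hi.1]

lemma analyticOnNhd_propagator {m : ℝ} (hm : 0 ≤ m) (t : ℝ) :
    AnalyticOnNhd ℂ (propagator m t) (contourRegion t) := by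
  intro z hz
  have h1 := (analyticAt_halfLinePropagator hm t (sub_mem_cone_of_mem_contourRegion hz)).fun_comp
    (f := fun z : ℂ => z - t) (by fun_prop)
  have h2 := (analyticAt_halfLinePropagator hm t
    (sub_mem_cone_of_mem_contourRegion (neg_mem_contourRegion hz))).fun_comp
    (f := fun z : ℂ => -z - t) (by fun_prop)
  exact analyticAt_const.mul ((analyticAt_const.mul h1).add (analyticAt_const.mul h2))

lemma isPropagatorContinuation_propagator {m : ℝ} (hm : 0 ≤ m) (t : ℝ) :
    IsPropagatorContinuation m t (propagator m t) where
  analytic := analyticOnNhd_propagator hm t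
  real_values x hx hx' := by
    have h1 := tendsto_integral_planeWave hm t hx
    have h2 := tendsto_integral_planeWave hm t (x := -x) (fun h => hx' (by linarith))
    rw [Complex.ofReal_neg] at h2
    refine ((h1.add h2).const_mul (1 / (2 * Real.pi : ℂ))).congr' ?_
    filter_upwards [self_mem_nhdsWithin] with η hη
    exact (regularizedPropagator_eq hm t x hη).symm

lemma ofReal_mem_contourRegion {t x : ℝ} (h : x ≠ t) (h' : x ≠ -t) :
    (x : ℂ) ∈ contourRegion t :=
  ⟨by exact_mod_cast h, by exact_mod_cast h', Or.inl (Complex.ofReal_im x)⟩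

/-! ### Uniqueness of the continuation -/

lemma IsPropagatorContinuation.eq_ofReal {m t : ℝ} {G G' : ℂ → ℂ}
    (hG : IsPropagatorContinuation m t G) (hG' : IsPropagatorContinuation m t G') {x : ℝ}
    (h : x ≠ t) (h' : x ≠ -t) : G x = G' x :=
  tendsto_nhds_unique (hG.real_values x h h') (hG'.real_values x h h')

/-- On the real axis both functions are the same limit. A non-real point is joined to t/2 or -t/2 by
a segment that stays in its half-disc by convexity, and the identity theorem carries the equality
along it. -/
lemma IsPropagatorContinuation.eqOn {m t : ℝ} {G G' : ℂ → ℂ} (ht : 0 < t)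
    (hG : IsPropagatorContinuation m t G) (hG' : IsPropagatorContinuation m t G') :
    Set.EqOn G G' (contourRegion t) := by
  have key : ∀ (z : ℂ) (x : ℝ), x ≠ t → x ≠ -t → segment ℝ (x : ℂ) z ⊆ contourRegion t →
      G z = G' z := by
    intro z x h h' hs
    refine (hG.analytic.mono hs).eqOn_of_preconnected_of_frequently_eq (hG'.analytic.mono hs)
      (convex_segment _ _).isPreconnected (left_mem_segment ℝ _ _) ?_ (right_mem_segment ℝ _ _)
    have hev : ∀ᶠ y : ℝ in 𝓝[≠] x, G y = G' y := by
      have : ∀ᶠ y : ℝ in 𝓝 x, y ≠ t ∧ y ≠ -t :=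
        (eventually_ne_nhds h).and (eventually_ne_nhds h')
      filter_upwards [nhdsWithin_le_nhds this] with y hy
      exact hG.eq_ofReal hG' hy.1 hy.2
    have htend : Tendsto (fun y : ℝ => (y : ℂ)) (𝓝[≠] x) (𝓝[≠] (x : ℂ)) :=
      (Complex.continuous_ofReal.tendsto x).inf
        (tendsto_principal_principal.2 fun y hy => by simpa using hy)
    exact htend.frequently hev.frequently
  intro z hz
  have hz' := hz
  obtain ⟨h1, h2, h3⟩ := hz'
  rcases h3 with h | ⟨him, hn⟩ | ⟨him, hn⟩
  · have hzr : z = (z.re : ℂ) := Complex.ext (by simp) (by simpa using h)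
    rw [hzr] at h1 h2 ⊢
    exact hG.eq_ofReal hG' (by exact_mod_cast h1) (by exact_mod_cast h2)
  · refine key z (t / 2) (by linarith) (by linarith) ?_
    rw [segment_eq_image]
    rintro - ⟨θ, ⟨hθ0, hθ1⟩, rfl⟩
    rcases hθ0.eq_or_lt with rfl | hθ0
    · simpa using ofReal_mem_contourRegion (t := t) (x := t / 2) (by linarith) (by linarith)
    · have him' : 0 < ((1 - θ) • ((t / 2 : ℝ) : ℂ) + θ • z).im := by
        simpa using mul_pos hθ0 him
      refine ⟨fun h => ?_, fun h => ?_, Or.inr (Or.inl ⟨him', ?_⟩)⟩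
      · exact him'.ne' ((congrArg Complex.im h).trans (by simp))
      · exact him'.ne' ((congrArg Complex.im h).trans (by simp))
      · rw [← dist_eq_norm, ← Metric.mem_ball]
        refine (convex_ball (t : ℂ) t) (x := ((t / 2 : ℝ) : ℂ)) ?_ (y := z) ?_ (by linarith)
          hθ0.le (by ring)
        · rw [Metric.mem_ball, dist_eq_norm, ← Complex.ofReal_sub, Complex.norm_real,
            Real.norm_eq_abs, abs_lt]
          constructor <;> linarith
        · rwa [Metric.mem_ball, dist_eq_norm]
  · refine key z (-(t / 2)) (by linarith) (by linarith) ?_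
    rw [segment_eq_image]
    rintro - ⟨θ, ⟨hθ0, hθ1⟩, rfl⟩
    rcases hθ0.eq_or_lt with rfl | hθ0
    · simpa using ofReal_mem_contourRegion (t := t) (x := -(t / 2)) (by linarith) (by linarith)
    · have him' : ((1 - θ) • ((-(t / 2) : ℝ) : ℂ) + θ • z).im < 0 := by
        simpa using mul_neg_of_pos_of_neg hθ0 him
      refine ⟨fun h => ?_, fun h => ?_, Or.inr (Or.inr ⟨him', ?_⟩)⟩
      · exact him'.ne ((congrArg Complex.im h).trans (by simp))
      · exact him'.ne ((congrArg Complex.im h).trans (by simp))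
      · rw [← sub_neg_eq_add, ← dist_eq_norm, ← Metric.mem_ball]
        refine (convex_ball (-t : ℂ) t) (x := ((-(t / 2) : ℝ) : ℂ)) ?_ (y := z) ?_ (by linarith)
          hθ0.le (by ring)
        · rw [Metric.mem_ball, dist_eq_norm, ← Complex.ofReal_neg, ← Complex.ofReal_sub,
            Complex.norm_real, Real.norm_eq_abs, abs_lt]
          constructor <;> linarith
        · rwa [Metric.mem_ball, dist_eq_norm, sub_neg_eq_add]

/-! ### Pole parts and limits of the arcs -/

/-- The residue of the propagator at `t`. -/
def poleCoeff (m t : ℝ) : ℂ := Complex.I / (2 * Real.pi) * Complex.exp (Complex.I * m * t)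

/-- The closed upper half-plane without the point `t`. -/
def puncturedUpper (t : ℝ) : Set ℂ := {z | z ≠ (t : ℂ) ∧ 0 ≤ z.im}

lemma mem_contourRegion_of_mem_puncturedUpper {t : ℝ} {z : ℂ} (ht : 0 < t)
    (hz : z ∈ puncturedUpper t) (hn : ‖z - t‖ < t) : z ∈ contourRegion t := by
  refine ⟨hz.1, ?_, ?_⟩
  · rintro rfl
    have : ‖-(t : ℂ) - t‖ = 2 * t := by
      rw [← Complex.ofReal_neg, ← Complex.ofReal_sub, Complex.norm_real, Real.norm_eq_abs,
        abs_of_neg (by linarith)]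
      ring
    linarith
  · rcases hz.2.eq_or_lt with h | h
    · exact Or.inl h.symm
    · exact Or.inr (Or.inl ⟨h, hn⟩)

/-- Only the positive momenta are singular at t. The reflected term is evaluated near -2t, where it
is analytic, and being bounded it is absorbed by the power -1/2. -/
lemma propagator_sub_pole_isBigO {m : ℝ} (hm : 0 ≤ m) {t : ℝ} (ht : 0 < t) :
    (fun z : ℂ => propagator m t z - poleCoeff m t / (z - t)) =O[𝓝[puncturedUpper t] (t : ℂ)]
      (fun z : ℂ => ‖z - t‖ ^ (-(1 / 2) : ℝ)) := by
  obtain ⟨K, hK, hKb⟩ := norm_halfLinePropagator_sub_le hm t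
  have h1 : (fun z : ℂ => halfLinePropagator m t (z - t) - Complex.I / (z - t))
      =O[𝓝[puncturedUpper t] (t : ℂ)] (fun z : ℂ => ‖z - t‖ ^ (-(1 / 2) : ℝ)) := by
    refine Asymptotics.IsBigO.of_bound K ?_
    filter_upwards [self_mem_nhdsWithin] with z hz
    rw [Real.norm_of_nonneg (by positivity)]
    exact hKb _ (sub_ne_zero.2 hz.1) (by simpa using hz.2)
  have h2 : (fun z : ℂ => halfLinePropagator m t (-z - t))
      =O[𝓝[puncturedUpper t] (t : ℂ)] (fun z : ℂ => ‖z - t‖ ^ (-(1 / 2) : ℝ)) := by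
    have hc : ContinuousAt (fun z : ℂ => halfLinePropagator m t (-z - t)) (t : ℂ) := by
      refine (analyticAt_halfLinePropagator hm t (w := -(t : ℂ) - t) ?_).continuousAt.comp
        (f := fun z : ℂ => -z - t) (by fun_prop)
      right
      simp
      linarith
    have hone : (fun z : ℂ => halfLinePropagator m t (-z - t))
        =O[𝓝[puncturedUpper t] (t : ℂ)] (fun _ => (1 : ℝ)) :=
      (hc.tendsto.mono_left nhdsWithin_le_nhds).isBigO_one ℝ
    refine hone.trans (Asymptotics.IsBigO.of_bound 1 ?_)
    filter_upwards [self_mem_nhdsWithin,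
      nhdsWithin_le_nhds (Metric.ball_mem_nhds (t : ℂ) one_pos)] with z hz hz1
    rw [mem_ball_iff_norm] at hz1
    have : 0 < ‖z - t‖ := norm_pos_iff.2 (sub_ne_zero.2 hz.1)
    rw [norm_one, one_mul, Real.norm_of_nonneg (by positivity)]
    exact Real.one_le_rpow_of_pos_of_le_one_of_nonpos this hz1.le (by norm_num)
  refine ((h1.add h2).const_mul_left
    (1 / (2 * Real.pi) * Complex.exp (Complex.I * m * t))).congr_left fun z => ?_
  rw [propagator, poleCoeff]
  ring

lemma sub_pole_isBigO {m : ℝ} (hm : 0 ≤ m) {t : ℝ} (ht : 0 < t) {G : ℂ → ℂ}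
    (hG : Set.EqOn G (propagator m t) (contourRegion t)) :
    (fun z : ℂ => G z - poleCoeff m t / (z - t)) =O[𝓝[puncturedUpper t] (t : ℂ)]
      (fun z : ℂ => ‖z - t‖ ^ (-(1 / 2) : ℝ)) := by
  refine (propagator_sub_pole_isBigO hm ht).congr' ?_ EventuallyEq.rfl
  filter_upwards [self_mem_nhdsWithin,
    nhdsWithin_le_nhds (Metric.ball_mem_nhds (t : ℂ) ht)] with z hz hz1
  rw [mem_ball_iff_norm] at hz1
  rw [hG (mem_contourRegion_of_mem_puncturedUpper ht hz hz1)]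

lemma tendsto_sub_mul {m : ℝ} (hm : 0 ≤ m) {t : ℝ} (ht : 0 < t) {G : ℂ → ℂ}
    (hG : Set.EqOn G (propagator m t) (contourRegion t)) :
    Tendsto (fun z : ℂ => (z - t) * G z) (𝓝[puncturedUpper t] (t : ℂ)) (𝓝 (poleCoeff m t)) := by
  have h1 : (fun z : ℂ => (z - t) * (G z - poleCoeff m t / (z - t)))
      =O[𝓝[puncturedUpper t] (t : ℂ)] (fun z : ℂ => ‖z - t‖ ^ (1 / 2 : ℝ)) := by
    refine ((Asymptotics.isBigO_refl (fun z : ℂ => z - t) _).norm_right.mul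
      (sub_pole_isBigO hm ht hG)).congr' EventuallyEq.rfl ?_
    filter_upwards [self_mem_nhdsWithin] with z hz
    have : 0 < ‖z - t‖ := norm_pos_iff.2 (sub_ne_zero.2 hz.1)
    rw [mul_comm, ← Real.rpow_add_one this.ne']
    norm_num
  have h2 : Tendsto (fun z : ℂ => ‖z - t‖ ^ (1 / 2 : ℝ)) (𝓝[puncturedUpper t] (t : ℂ)) (𝓝 0) := by
    have : Continuous (fun z : ℂ => ‖z - t‖ ^ (1 / 2 : ℝ)) :=
      (by fun_prop : Continuous fun z : ℂ => ‖z - t‖).rpow_const fun _ => Or.inr (by norm_num)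
    have h := (this.tendsto (t : ℂ)).mono_left (nhdsWithin_le_nhds (s := puncturedUpper t))
    simpa using h
  have h3 := (h1.trans_tendsto h2).add_const (poleCoeff m t)
  rw [zero_add] at h3
  refine h3.congr' ?_
  filter_upwards [self_mem_nhdsWithin] with z hz
  have : z - t ≠ 0 := sub_ne_zero.2 hz.1
  field_simp
  ring

lemma upperArc_mem {t ε θ : ℝ} (hε : 0 < ε) (hθ : θ ∈ Set.Ioc 0 Real.pi) :
    (t : ℂ) + ε * Complex.exp (θ * Complex.I) ∈ puncturedUpper t := by
  refine ⟨fun h => ?_, ?_⟩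
  · rw [add_eq_left] at h
    exact mul_ne_zero (by exact_mod_cast hε.ne') (Complex.exp_ne_zero _) h
  · have : 0 ≤ Real.sin θ := Real.sin_nonneg_of_nonneg_of_le_pi hθ.1.le hθ.2
    simp only [Complex.add_im, Complex.ofReal_im, zero_add, Complex.im_ofReal_mul,
      Complex.exp_ofReal_mul_I_im]
    positivity

lemma norm_upperArc_sub {t ε : ℝ} (hε : 0 < ε) (θ : ℝ) :
    ‖(t : ℂ) + ε * Complex.exp (θ * Complex.I) - t‖ = ε := by
  rw [add_sub_cancel_left, norm_mul, Complex.norm_exp_ofReal_mul_I, mul_one, Complex.norm_real,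
    Real.norm_of_nonneg hε.le]

/-- The small upper semicircle around `t` picks up `-πi` times the residue. -/
lemma tendsto_upperArcIntegral {m : ℝ} (hm : 0 ≤ m) {t : ℝ} (ht : 0 < t) {G Φ : ℂ → ℂ}
    (hG : Set.EqOn G (propagator m t) (contourRegion t)) (hΦ : Measurable Φ)
    (hΦt : ContinuousAt Φ (t : ℂ)) :
    Tendsto (fun ε : ℝ => upperArcIntegral t ε (fun z => G z * Φ z)) (𝓝[>] 0)
      (𝓝 (1 / 2 * Φ t * Complex.exp (Complex.I * m * t))) := by
  have hlim : Tendsto (fun z : ℂ => (z - t) * (G z * Φ z)) (𝓝[puncturedUpper t] (t : ℂ))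
      (𝓝 (poleCoeff m t * Φ t)) :=
    ((tendsto_sub_mul hm ht hG).mul (hΦt.tendsto.mono_left nhdsWithin_le_nhds)).congr
      fun z => by ring
  -- On the arc dz = i(z - t) dθ, which cancels the pole and keeps the integrand bounded.
  have hint : ∀ ε θ : ℝ, (G (t + ε * Complex.exp (θ * Complex.I)) *
      Φ (t + ε * Complex.exp (θ * Complex.I))) * (Complex.I * ε * Complex.exp (θ * Complex.I)) =
      Complex.I * (((t + ε * Complex.exp (θ * Complex.I) : ℂ) - t) *
        (G (t + ε * Complex.exp (θ * Complex.I)) *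
          Φ (t + ε * Complex.exp (θ * Complex.I)))) := by
    intro ε θ; ring
  -- The angle decreases from π to 0, and i · i/(2π) · (-π) = 1/2.
  have hval : ∫ _θ in Real.pi..(0 : ℝ), Complex.I * (poleCoeff m t * Φ t) =
      1 / 2 * Φ t * Complex.exp (Complex.I * m * t) := by
    have hpi : (Real.pi : ℂ) ≠ 0 := by exact_mod_cast Real.pi_ne_zero
    rw [intervalIntegral.integral_const, poleCoeff, Complex.real_smul]
    push_cast
    field_simp
    linear_combination (-Real.pi * Φ t : ℂ) * Complex.I_sq
  rw [← hval]
  simp only [upperArcIntegral, hint]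
  obtain ⟨ρ, hρ, hρb⟩ : ∃ ρ > 0, ∀ z ∈ puncturedUpper t, ‖z - t‖ < ρ →
      ‖(z - t) * (G z * Φ z)‖ ≤ ‖poleCoeff m t * Φ t‖ + 1 := by
    have hev : ∀ᶠ z in 𝓝[puncturedUpper t] (t : ℂ),
        ‖(z - t) * (G z * Φ z)‖ ≤ ‖poleCoeff m t * Φ t‖ + 1 :=
      (hlim.norm.eventually_lt_const (lt_add_one _)).mono fun z hz => hz.le
    obtain ⟨ρ, hρ, h⟩ := Metric.mem_nhdsWithin_iff.1 hev
    exact ⟨ρ, hρ, fun z hz hn => h ⟨mem_ball_iff_norm.2 hn, hz⟩⟩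
  have huIoc : Set.uIoc Real.pi 0 = Set.Ioc 0 Real.pi := by
    rw [Set.uIoc_comm, Set.uIoc_of_le Real.pi_pos.le]
  refine intervalIntegral.tendsto_integral_filter_of_dominated_convergence
    (fun _ => ‖poleCoeff m t * Φ t‖ + 1) ?_ ?_ ?_ ?_
  · filter_upwards [Ioo_mem_nhdsGT ht] with ε hε
    rw [huIoc]
    have hcont : ContinuousOn (fun θ : ℝ => G (t + ε * Complex.exp (θ * Complex.I)))
        (Set.Ioc 0 Real.pi) := by
      intro θ hθ
      have hmem := mem_contourRegion_of_mem_puncturedUpper ht (upperArc_mem hε.1 hθ)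
        ((norm_upperArc_sub hε.1 θ).trans_lt hε.2)
      have hGc : ContinuousOn G (contourRegion t) :=
        (analyticOnNhd_propagator hm t).continuousOn.congr hG
      refine (hGc _ hmem).comp (f := fun θ : ℝ => (t : ℂ) + ε * Complex.exp (θ * Complex.I))
        (by fun_prop) fun θ' hθ' => ?_
      exact mem_contourRegion_of_mem_puncturedUpper ht (upperArc_mem hε.1 hθ')
        ((norm_upperArc_sub hε.1 θ').trans_lt hε.2)
    have hmeas : Measurable (fun θ : ℝ => Φ (t + ε * Complex.exp (θ * Complex.I))) :=
      hΦ.comp (by fun_prop)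
    refine AEStronglyMeasurable.const_mul ?_ _
    refine AEStronglyMeasurable.mul (by fun_prop) ?_
    exact (hcont.aestronglyMeasurable measurableSet_Ioc).mul hmeas.aestronglyMeasurable
  · filter_upwards [Ioo_mem_nhdsGT hρ] with ε hε
    refine Eventually.of_forall fun θ hθ => ?_
    rw [huIoc] at hθ
    rw [norm_mul, Complex.norm_I, one_mul]
    exact hρb _ (upperArc_mem hε.1 hθ) ((norm_upperArc_sub hε.1 θ).trans_lt hε.2)
  · exact intervalIntegrable_const
  · refine Eventually.of_forall fun θ hθ => ?_
    rw [huIoc] at hθ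
    refine Tendsto.const_mul _ (hlim.comp (tendsto_nhdsWithin_iff.2 ⟨?_, ?_⟩))
    · have : Continuous fun ε : ℝ => (t : ℂ) + ε * Complex.exp (θ * Complex.I) := by fun_prop
      have h := (this.tendsto 0).mono_left (nhdsWithin_le_nhds (s := Set.Ioi 0))
      simpa using h
    · filter_upwards [self_mem_nhdsWithin] with ε hε
      exact upperArc_mem hε hθ

/-- Shifting θ by π is the point reflection z ↦ -z; the sign it puts on dz reverses the limits of
integration. -/
lemma lowerArcIntegral_eq (t ε : ℝ) (f : ℂ → ℂ) :
    lowerArcIntegral t ε f = upperArcIntegral t ε (fun z => f (-z)) := by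
  have h := intervalIntegral.integral_comp_add_right (a := 0) (b := Real.pi)
    (fun θ : ℝ => f (-(t : ℂ) + ε * Complex.exp (θ * Complex.I)) *
      (Complex.I * ε * Complex.exp (θ * Complex.I))) Real.pi
  rw [zero_add, ← two_mul] at h
  rw [lowerArcIntegral, ← h, upperArcIntegral, intervalIntegral.integral_symm 0 Real.pi,
    ← intervalIntegral.integral_neg]
  refine intervalIntegral.integral_congr fun θ _ => ?_
  have he : Complex.exp (((θ + Real.pi : ℝ) : ℂ) * Complex.I) =
      -Complex.exp (θ * Complex.I) := by
    push_cast
    rw [add_mul, Complex.exp_add, Complex.exp_pi_mul_I, mul_neg_one]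
  simp only [he]
  rw [show -(t : ℂ) + ε * -Complex.exp (θ * Complex.I) =
    -(t + ε * Complex.exp (θ * Complex.I)) by ring]
  ring

/-! ### Principal values of cut-off poles -/

lemma measurableSet_offPoles (t ε : ℝ) : MeasurableSet (offPoles t ε) := by
  have h1 : MeasurableSet {y : ℝ | ε ≤ |y - t|} := measurableSet_le measurable_const (by fun_prop)
  have h2 : MeasurableSet {y : ℝ | ε ≤ |y + t|} := measurableSet_le measurable_const (by fun_prop)
  exact h1.inter h2

lemma tendsto_integral_offPoles (t : ℝ) {g : ℝ → ℂ} (hg : Integrable g) :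
    Tendsto (fun ε : ℝ => ∫ y in offPoles t ε, g y) (𝓝[>] 0) (𝓝 (∫ y, g y)) := by
  simp only [← integral_indicator (measurableSet_offPoles t _)]
  refine tendsto_integral_filter_of_dominated_convergence (fun y => ‖g y‖)
    (Eventually.of_forall fun ε =>
      hg.aestronglyMeasurable.indicator (measurableSet_offPoles t ε))
    (Eventually.of_forall fun ε => Eventually.of_forall fun y => norm_indicator_le_norm_self _ _)
    hg.norm ?_
  have hne : ∀ᵐ y : ℝ, y ≠ t ∧ y ≠ -t :=
    (Measure.ae_ne volume t).and (Measure.ae_ne volume (-t))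
  filter_upwards [hne] with y hy
  have h1 : 0 < |y - t| := abs_pos.2 (sub_ne_zero.2 hy.1)
  have h2 : 0 < |y + t| := abs_pos.2 (fun h => hy.2 (eq_neg_of_add_eq_zero_left h))
  refine tendsto_const_nhds.congr' ?_
  filter_upwards [Ioo_mem_nhdsGT (lt_min h1 h2)] with ε hε
  exact (Set.indicator_of_mem
    (show y ∈ offPoles t ε from ⟨(hε.2.trans_le (min_le_left _ _)).le,
      (hε.2.trans_le (min_le_right _ _)).le⟩) g).symm

/-- The simple pole `1 / (y - a)` cut off at distance `ρ`. -/
def truncatedPole (a ρ : ℝ) : ℝ → ℂ :=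
  (Metric.ball a ρ).indicator fun y => ((y : ℂ) - a)⁻¹

/-- The function `1 / u` restricted to `ε ≤ |u| < ρ`. -/
def annularPole (ε ρ : ℝ) : ℝ → ℂ :=
  {u : ℝ | ε ≤ |u| ∧ |u| < ρ}.indicator fun u => (u : ℂ)⁻¹

lemma integrable_annularPole {ε : ℝ} (hε : 0 < ε) (ρ : ℝ) : Integrable (annularPole ε ρ) := by
  have hmeas : MeasurableSet {u : ℝ | ε ≤ |u| ∧ |u| < ρ} := by
    have h1 : MeasurableSet {u : ℝ | ε ≤ |u|} := measurableSet_le measurable_const (by fun_prop)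
    have h2 : MeasurableSet {u : ℝ | |u| < ρ} := measurableSet_lt (by fun_prop) measurable_const
    exact h1.inter h2
  refine IntegrableOn.integrable_indicator ?_ hmeas
  refine Measure.integrableOn_of_bounded (M := ε⁻¹) ?_ ?_ ?_
  · refine (measure_mono (t := Metric.ball 0 ρ) fun u hu => ?_).trans_lt measure_ball_lt_top |>.ne
    simpa using hu.2
  · exact (by fun_prop : Measurable fun u : ℝ => (u : ℂ)⁻¹).aestronglyMeasurable
  · filter_upwards [ae_restrict_mem hmeas] with u hu
    rw [norm_inv, Complex.norm_real, Real.norm_eq_abs]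
    exact inv_anti₀ hε hu.1

lemma integral_annularPole (ε ρ : ℝ) : ∫ u, annularPole ε ρ u = 0 := by
  have h := integral_neg_eq_self (annularPole ε ρ) volume
  have hodd : ∀ u, annularPole ε ρ (-u) = -annularPole ε ρ u := by
    intro u
    by_cases hu : u ∈ {u : ℝ | ε ≤ |u| ∧ |u| < ρ}
    · have hu' : -u ∈ {u : ℝ | ε ≤ |u| ∧ |u| < ρ} := by simpa using hu
      simp only [annularPole]
      rw [Set.indicator_of_mem hu, Set.indicator_of_mem hu', Complex.ofReal_neg, inv_neg]
    · have hu' : -u ∉ {u : ℝ | ε ≤ |u| ∧ |u| < ρ} := by simpa using hu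
      simp only [annularPole]
      rw [Set.indicator_of_notMem hu, Set.indicator_of_notMem hu', neg_zero]
  simp only [hodd, integral_neg] at h
  exact neg_eq_self.1 h

/-- The poles are 2t apart, so for ε < t the ball of radius t about one misses the gap around the
other, and a symmetric annulus remains. -/
lemma indicator_offPoles_truncatedPole {t a ε : ℝ} (ha : a = t ∨ a = -t) (hε : ε < t) :
    (offPoles t ε).indicator (truncatedPole a t) = fun y => annularPole ε t (y - a) := by
  have hiff : ∀ y, (y ∈ offPoles t ε ∧ y ∈ Metric.ball a t) ↔
      y - a ∈ {u : ℝ | ε ≤ |u| ∧ |u| < t} := by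
    intro y
    simp only [offPoles, Set.mem_ofPred_eq, Metric.mem_ball, Real.dist_eq]
    constructor
    · rintro ⟨⟨h1, h2⟩, h3⟩
      rcases ha with rfl | rfl
      · exact ⟨h1, h3⟩
      · exact ⟨by rwa [sub_neg_eq_add], h3⟩
    · rintro ⟨h1, h2⟩
      refine ⟨?_, h2⟩
      rcases ha with rfl | rfl
      · refine ⟨h1, hε.le.trans ?_⟩
        rw [abs_lt] at h2
        exact le_abs.2 (Or.inl (by linarith))
      · refine ⟨hε.le.trans ?_, by rwa [sub_neg_eq_add] at h1⟩
        rw [abs_lt] at h2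
        exact le_abs.2 (Or.inr (by linarith))
  funext y
  rw [truncatedPole, Set.indicator_indicator, annularPole]
  by_cases h : y ∈ offPoles t ε ∩ Metric.ball a t
  · rw [Set.indicator_of_mem h, Set.indicator_of_mem ((hiff y).1 h), Complex.ofReal_sub]
  · rw [Set.indicator_of_notMem h, Set.indicator_of_notMem (fun h' => h ((hiff y).2 h'))]

lemma integrableOn_truncatedPole {t a ε : ℝ} (ha : a = t ∨ a = -t) (hε : 0 < ε) (hεt : ε < t) :
    IntegrableOn (truncatedPole a t) (offPoles t ε) := by
  rw [← integrable_indicator_iff (measurableSet_offPoles t ε),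
    indicator_offPoles_truncatedPole ha hεt]
  exact (integrable_annularPole hε t).comp_sub_right a

lemma setIntegral_truncatedPole {t a ε : ℝ} (ha : a = t ∨ a = -t) (hεt : ε < t) :
    ∫ y in offPoles t ε, truncatedPole a t y = 0 := by
  rw [← integral_indicator (measurableSet_offPoles t ε), indicator_offPoles_truncatedPole ha hεt,
    integral_sub_right_eq_self (annularPole ε t) a, integral_annularPole]

/-! ### Local integrability and existence of the principal value -/

lemma integrableAtFilter_truncatedPole {a ρ y : ℝ} (h : y ≠ a) :
    IntegrableAtFilter (truncatedPole a ρ) (𝓝 y) := by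
  have hc : ContinuousOn (fun y : ℝ => ((y : ℂ) - a)⁻¹) {a}ᶜ := by
    refine ContinuousOn.inv₀ (by fun_prop) fun z hz => ?_
    rw [sub_ne_zero]
    exact_mod_cast hz
  have hl := hc.locallyIntegrableOn (μ := volume) isOpen_compl_singleton.measurableSet y h
  rw [isOpen_compl_singleton.nhdsWithin_eq h] at hl
  obtain ⟨s, hs, hi⟩ := hl
  exact ⟨s, hs, hi.indicator Metric.isOpen_ball.measurableSet⟩

lemma integrableAtFilter_of_nhdsNE {f : ℝ → ℂ} {a : ℝ} (h : IntegrableAtFilter f (𝓝[≠] a)) :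
    IntegrableAtFilter f (𝓝 a) := by
  obtain ⟨s, hs, hi⟩ := h
  refine ⟨insert a s, insert_mem_nhds_iff.2 hs, ?_⟩
  rw [Set.insert_eq]
  exact (integrableOn_singleton (hx := by rw [Real.volume_singleton]; exact ENNReal.zero_lt_top)).union hi

lemma integrableAtFilter_abs_sub_rpow {a β : ℝ} (hβ : -1 < β) (l : Filter ℝ) (hl : l ≤ 𝓝 a) :
    IntegrableAtFilter (fun y : ℝ => |y - a| ^ β) l := by
  have h0 : LocallyIntegrable (fun u : ℝ => |u| ^ β) := by
    refine locallyIntegrable_of_norm_le_rpow (α := -β) (C := 1) (by simp) (by simp; linarith)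
      (Eventually.of_forall fun u => ?_)
      (by fun_prop : Measurable fun u : ℝ => |u| ^ β).aestronglyMeasurable
    rw [Real.norm_of_nonneg (by positivity), neg_neg, one_mul, Real.norm_eq_abs]
  have h1 : IntegrableOn (fun u : ℝ => |u| ^ β) (Metric.ball 0 1) :=
    (h0.integrableOn_isCompact (isCompact_closedBall 0 1)).mono_set Metric.ball_subset_closedBall
  refine ⟨Metric.ball a 1, hl (Metric.ball_mem_nhds a one_pos), ?_⟩
  rw [← integrable_indicator_iff Metric.isOpen_ball.measurableSet] at h1 ⊢
  refine (h1.comp_sub_right a).congr (Eventually.of_forall fun y => ?_)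
  by_cases hy : y ∈ Metric.ball a 1
  · have hy' : y - a ∈ Metric.ball (0 : ℝ) 1 := by
      simpa [Real.dist_eq] using hy
    simp only [Set.indicator_of_mem hy, Set.indicator_of_mem hy']
  · have hy' : y - a ∉ Metric.ball (0 : ℝ) 1 := by
      simpa [Real.dist_eq] using hy
    simp only [Set.indicator_of_notMem hy, Set.indicator_of_notMem hy']

/-- Removing the pole from the product of a function with a simple pole and a Hölder continuous
function leaves an integrable singularity. -/
lemma integrableAtFilter_mul_sub_pole {g φ : ℝ → ℂ} {a α : ℝ} {c : ℂ} {U : Set ℝ}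
    (hU : IsOpen U) (hUa : U ∈ 𝓝[≠] a) (hUa' : a ∉ U)
    (hg : ContinuousOn g U) (hφ : Continuous φ) (hα : 0 < α)
    (hpole : (fun y : ℝ => g y - c * ((y : ℂ) - a)⁻¹) =O[𝓝[≠] a]
      fun y => |y - a| ^ (-(1 / 2) : ℝ))
    (hhol : (fun y : ℝ => φ y - φ a) =O[𝓝 a] fun y => |y - a| ^ α) :
    IntegrableAtFilter (fun y : ℝ => g y * φ y - c * φ a * ((y : ℂ) - a)⁻¹) (𝓝 a) := by
  have hinv : ContinuousOn (fun y : ℝ => ((y : ℂ) - a)⁻¹) U := by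
    refine ContinuousOn.inv₀ (by fun_prop) fun z hz => ?_
    rw [sub_ne_zero]
    rintro h
    exact hUa' (by rwa [← Complex.ofReal_injective h])
  have hmeas : ∀ {f : ℝ → ℂ}, ContinuousOn f U → StronglyMeasurableAtFilter f (𝓝[≠] a) :=
    fun hf => ⟨U, hUa, hf.aestronglyMeasurable hU.measurableSet⟩
  apply integrableAtFilter_of_nhdsNE
  have : (𝓝[≠] a).IsMeasurablyGenerated :=
    (measurableSet_singleton a).compl.nhdsWithin_isMeasurablyGenerated a
  -- The difference splits as (g - c/(y - a)) φ + c (φ - φ(a))/(y - a), of orders |y - a|^(-1/2) and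
  -- |y - a|^(α - 1), both integrable.
  have h1 : IntegrableAtFilter (fun y : ℝ => (g y - c * ((y : ℂ) - a)⁻¹) * φ y) (𝓝[≠] a) := by
    have hb : φ =O[𝓝[≠] a] fun _ => (1 : ℝ) :=
      ((hφ.tendsto a).mono_left nhdsWithin_le_nhds).isBigO_one ℝ
    have := hpole.mul hb
    simp only [mul_one] at this
    exact this.integrableAtFilter
      (hmeas ((hg.sub (continuousOn_const.mul hinv)).mul hφ.continuousOn))
      (integrableAtFilter_abs_sub_rpow (by norm_num) _ nhdsWithin_le_nhds)
  have h2 : IntegrableAtFilter (fun y : ℝ => c * ((φ y - φ a) * ((y : ℂ) - a)⁻¹)) (𝓝[≠] a) := by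
    have hi : (fun y : ℝ => ((y : ℂ) - a)⁻¹) =O[𝓝[≠] a] fun y => |y - a| ^ (-1 : ℝ) := by
      refine Asymptotics.IsBigO.of_bound 1 (Eventually.of_forall fun y => ?_)
      rw [Real.rpow_neg_one, norm_inv, norm_inv, ← Complex.ofReal_sub, Complex.norm_real,
        Real.norm_eq_abs, Real.norm_eq_abs, abs_abs, one_mul]
    have := (((hhol.mono nhdsWithin_le_nhds).mul hi).const_mul_left c)
    refine (this.congr' EventuallyEq.rfl ?_).integrableAtFilter
      (hmeas (continuousOn_const.mul ((hφ.continuousOn.sub continuousOn_const).mul hinv)))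
      (integrableAtFilter_abs_sub_rpow (β := α + -1) (by linarith) _ nhdsWithin_le_nhds)
    filter_upwards [self_mem_nhdsWithin] with y hy
    rw [Real.rpow_add (abs_pos.2 (sub_ne_zero.2 hy))]
  obtain ⟨s, hs, hi⟩ := h1.add h2
  refine ⟨s, hs, hi.congr (Eventually.of_forall fun y => ?_)⟩
  simp only [Pi.add_apply]
  ring

/-- The principal value exists for the product of a function with simple poles at `±t` and a
compactly supported function which is Hölder continuous at the poles. -/
lemma exists_hasPrincipalValue {t : ℝ} (ht : 0 < t) {g φ : ℝ → ℂ} {c₁ c₂ : ℂ} {α : ℝ}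
    (hg : ContinuousOn g {y | y ≠ t ∧ y ≠ -t}) (hφ : Continuous φ) (hφs : HasCompactSupport φ)
    (hα : 0 < α)
    (hpole₁ : (fun y : ℝ => g y - c₁ * ((y : ℂ) - t)⁻¹) =O[𝓝[≠] t]
      fun y => |y - t| ^ (-(1 / 2) : ℝ))
    (hpole₂ : (fun y : ℝ => g y - c₂ * ((y : ℂ) - (-t : ℝ))⁻¹) =O[𝓝[≠] (-t)]
      fun y => |y - -t| ^ (-(1 / 2) : ℝ))
    (hhol₁ : (fun y : ℝ => φ y - φ t) =O[𝓝 t] fun y => |y - t| ^ α)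
    (hhol₂ : (fun y : ℝ => φ y - φ (-t)) =O[𝓝 (-t)] fun y => |y - -t| ^ α) :
    ∃ L, HasPrincipalValue t (fun y => g y * φ y) L := by
  have htt : t ≠ -t := by linarith
  -- Cutting the poles off at radius t keeps the remainder compactly supported and makes their
  -- integrals over `offPoles t ε` vanish for ε < t.
  set p₁ : ℝ → ℂ := fun y => c₁ * φ t * truncatedPole t t y with hp₁
  set p₂ : ℝ → ℂ := fun y => c₂ * φ (-t) * truncatedPole (-t) t y with hp₂
  set R : ℝ → ℂ := fun y => g y * φ y - p₁ y - p₂ y with hR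
  have hUo : IsOpen {y : ℝ | y ≠ t ∧ y ≠ -t} :=
    isOpen_compl_singleton.inter isOpen_compl_singleton
  have hU₁ : {y : ℝ | y ≠ t ∧ y ≠ -t} ∈ 𝓝[≠] t :=
    inter_mem self_mem_nhdsWithin (nhdsWithin_le_nhds (isOpen_compl_singleton.mem_nhds htt))
  have hU₂ : {y : ℝ | y ≠ t ∧ y ≠ -t} ∈ 𝓝[≠] (-t) :=
    inter_mem (nhdsWithin_le_nhds (isOpen_compl_singleton.mem_nhds htt.symm)) self_mem_nhdsWithin
  have hmulc : ∀ {f : ℝ → ℂ} {y : ℝ} (c : ℂ), IntegrableAtFilter f (𝓝 y) →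
      IntegrableAtFilter (fun y => c * f y) (𝓝 y) := by
    rintro f y c ⟨s, hs, hi⟩
    exact ⟨s, hs, hi.const_mul c⟩
  have hcongr : ∀ {f f' : ℝ → ℂ} {y : ℝ}, IntegrableAtFilter f (𝓝 y) → f =ᶠ[𝓝 y] f' →
      IntegrableAtFilter f' (𝓝 y) := by
    intro f f' y hf h
    obtain ⟨s, hs, hi⟩ := hf
    obtain ⟨u, hu, huo, hyu⟩ := mem_nhds_iff.1 h
    refine ⟨s ∩ u, inter_mem hs (huo.mem_nhds hyu), ?_⟩
    refine (hi.mono_set Set.inter_subset_left).congr ?_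
    refine ae_restrict_of_ae_restrict_of_subset Set.inter_subset_right ?_
    filter_upwards [ae_restrict_mem huo.measurableSet] with z hz using hu hz
  have hloc : LocallyIntegrable R := by
    intro y
    by_cases h₁ : y = t
    · subst h₁
      have := (integrableAtFilter_mul_sub_pole hUo hU₁ (fun h => h.1 rfl) hg hφ hα hpole₁
        hhol₁).sub (hmulc (c₂ * φ (-y)) (integrableAtFilter_truncatedPole (ρ := y) htt))
      refine hcongr this ?_
      filter_upwards [Metric.ball_mem_nhds y ht] with z hz
      simp only [hR, hp₁, hp₂, Pi.sub_apply]
      rw [show truncatedPole y y z = _ from Set.indicator_of_mem hz _]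
    · by_cases h₂ : y = -t
      · subst h₂
        have := (integrableAtFilter_mul_sub_pole hUo hU₂ (fun h => h.2 rfl) hg hφ hα hpole₂
          hhol₂).sub (hmulc (c₁ * φ t) (integrableAtFilter_truncatedPole (ρ := t) htt.symm))
        refine hcongr this ?_
        filter_upwards [Metric.ball_mem_nhds (-t) ht] with z hz
        simp only [hR, hp₁, hp₂, Pi.sub_apply]
        rw [truncatedPole, truncatedPole, Set.indicator_of_mem hz]
        ring
      · have h := (hg.mul hφ.continuousOn).locallyIntegrableOn (μ := volume) hUo.measurableSet y
          ⟨h₁, h₂⟩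
        rw [hUo.nhdsWithin_eq ⟨h₁, h₂⟩] at h
        exact (h.sub (hmulc _ (integrableAtFilter_truncatedPole h₁))).sub
          (hmulc _ (integrableAtFilter_truncatedPole h₂))
  have hint : Integrable R := by
    set K : Set ℝ := tsupport φ ∪ (Metric.closedBall t t ∪ Metric.closedBall (-t) t) with hK
    have hKc : IsCompact K :=
      hφs.isCompact.union ((isCompact_closedBall _ _).union (isCompact_closedBall _ _))
    refine (integrableOn_iff_integrable_of_support_subset (s := K) ?_).1
      (hloc.integrableOn_isCompact hKc)
    intro y hy
    by_contra hyK
    simp only [hK, Set.mem_union, not_or] at hyK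
    obtain ⟨k1, k2, k3⟩ := hyK
    apply hy
    simp only [hR, hp₁, hp₂, truncatedPole]
    rw [image_eq_zero_of_notMem_tsupport k1,
      Set.indicator_of_notMem fun h => k2 (Metric.ball_subset_closedBall h),
      Set.indicator_of_notMem fun h => k3 (Metric.ball_subset_closedBall h)]
    simp
  refine ⟨∫ y, R y, (tendsto_integral_offPoles t hint).congr' ?_⟩
  filter_upwards [Ioo_mem_nhdsGT ht] with ε hε
  have i₁ : IntegrableOn p₁ (offPoles t ε) :=
    (integrableOn_truncatedPole (Or.inl rfl) hε.1 hε.2).const_mul _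
  have i₂ : IntegrableOn p₂ (offPoles t ε) :=
    (integrableOn_truncatedPole (Or.inr rfl) hε.1 hε.2).const_mul _
  have z₁ : ∫ y in offPoles t ε, p₁ y = 0 := by
    rw [hp₁, integral_const_mul, setIntegral_truncatedPole (Or.inl rfl) hε.2, mul_zero]
  have z₂ : ∫ y in offPoles t ε, p₂ y = 0 := by
    rw [hp₂, integral_const_mul, setIntegral_truncatedPole (Or.inr rfl) hε.2, mul_zero]
  have hsum : ∫ y in offPoles t ε, (R y + (p₁ y + p₂ y)) =
      (∫ y in offPoles t ε, R y) +
        ((∫ y in offPoles t ε, p₁ y) + ∫ y in offPoles t ε, p₂ y) := by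
    rw [← integral_add i₁ i₂]
    exact integral_add hint.integrableOn (i₁.add i₂)
  rw [z₁, z₂, add_zero, add_zero] at hsum
  rw [← hsum]
  refine integral_congr_ae (Eventually.of_forall fun y => ?_)
  simp only [hR]
  ring

/-! ### Comparison of the contour integral with the principal value -/

lemma tendsto_arcs {m : ℝ} (hm : 0 ≤ m) {t : ℝ} (ht : 0 < t) {G : ℂ → ℂ}
    (hG : Set.EqOn G (propagator m t) (contourRegion t)) {ψ₀ : ℝ → ℂ} {Ψ : ℂ → ℂ}
    (hΨ : IsComplexExtension ψ₀ Ψ) (x : ℝ) :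
    Tendsto (fun ε : ℝ => lowerArcIntegral t ε (fun z => G z * Ψ (x - z)) +
      upperArcIntegral t ε (fun z => G z * Ψ (x - z))) (𝓝[>] 0)
      (𝓝 (1 / 2 * ψ₀ (x - t) * Complex.exp (Complex.I * m * t) +
        1 / 2 * ψ₀ (x + t) * Complex.exp (Complex.I * m * t))) := by
  -- By evenness the reflected function is again the propagator on the region, so the lower arc is
  -- an instance of the upper one.
  have hG' : Set.EqOn (fun z => G (-z)) (propagator m t) (contourRegion t) := fun z hz =>
    (hG (neg_mem_contourRegion hz)).trans (propagator_neg m t z)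
  have hc : ∀ y : ℝ, ∀ f : ℂ → ℂ, Continuous f → f t = y →
      ContinuousAt (fun z => Ψ (f z)) (t : ℂ) := by
    intro y f hf hy
    have := hΨ.continuousAt_real y
    rw [← hy] at this
    exact this.comp hf.continuousAt
  have hup := tendsto_upperArcIntegral hm ht hG (Φ := fun z => Ψ (x - z))
    (hΨ.measurable.comp (by fun_prop))
    (hc (x - t) (fun z => x - z) (by fun_prop) (by push_cast; ring))
  have hlow := tendsto_upperArcIntegral hm ht hG' (Φ := fun z => Ψ (x - -z))
    (hΨ.measurable.comp (by fun_prop))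
    (hc (x + t) (fun z => x - -z) (by fun_prop) (by push_cast; ring))
  have e1 : Ψ ((x : ℂ) - t) = ψ₀ (x - t) := by rw [← hΨ.extends_real]; push_cast; rfl
  have e2 : Ψ ((x : ℂ) - -t) = ψ₀ (x + t) := by
    rw [← hΨ.extends_real, sub_neg_eq_add]; push_cast; rfl
  simp only [e1] at hup
  simp only [e2] at hlow
  simp only [lowerArcIntegral_eq]
  rw [add_comm (1 / 2 * ψ₀ (x - t) * _)]
  exact hlow.add hup

/-- The two truncated integrals differ by the arcs alone, whose limit always exists; adding or
subtracting it passes between the two limits. -/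
lemma hasPrincipalValue_iff_hasContourIntegral {m : ℝ} (hm : 0 ≤ m) {t : ℝ} (ht : 0 < t)
    {G : ℂ → ℂ} (hG : Set.EqOn G (propagator m t) (contourRegion t)) {ψ₀ : ℝ → ℂ} {Ψ : ℂ → ℂ}
    (hΨ : IsComplexExtension ψ₀ Ψ) (x : ℝ) (L : ℂ) :
    HasPrincipalValue t (fun y : ℝ => G (y : ℂ) * ψ₀ (x - y)) L ↔
      HasContourIntegral t (fun z : ℂ => G z * Ψ ((x : ℂ) - z))
        (L + 1 / 2 * ψ₀ (x - t) * Complex.exp (Complex.I * m * t)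
          + 1 / 2 * ψ₀ (x + t) * Complex.exp (Complex.I * m * t)) := by
  have harc := tendsto_arcs hm ht hG hΨ x
  have hreal : ∀ ε, ∫ y in offPoles t ε, G (y : ℂ) * Ψ ((x : ℂ) - (y : ℂ)) =
      ∫ y in offPoles t ε, G (y : ℂ) * ψ₀ (x - y) := by
    intro ε
    refine integral_congr_ae (Eventually.of_forall fun y => ?_)
    simp only [← hΨ.extends_real, Complex.ofReal_sub]
  unfold HasPrincipalValue HasContourIntegral indentedContourIntegral
  simp only [hreal, add_assoc]
  constructor
  · intro h
    exact h.add harc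
  · intro h
    simpa using h.sub harc

lemma real_pole_isBigO {m : ℝ} (hm : 0 ≤ m) {t : ℝ} (ht : 0 < t) {G : ℂ → ℂ}
    (hG : Set.EqOn G (propagator m t) (contourRegion t)) :
    (fun y : ℝ => G y - poleCoeff m t * ((y : ℂ) - t)⁻¹) =O[𝓝[≠] t]
      fun y => |y - t| ^ (-(1 / 2) : ℝ) := by
  have htend : Tendsto (fun y : ℝ => (y : ℂ)) (𝓝[≠] t) (𝓝[puncturedUpper t] (t : ℂ)) := by
    refine tendsto_nhdsWithin_iff.2
      ⟨(Complex.continuous_ofReal.tendsto t).mono_left nhdsWithin_le_nhds, ?_⟩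
    filter_upwards [self_mem_nhdsWithin] with y hy
    exact ⟨fun h => hy (Complex.ofReal_injective h), by simp⟩
  refine ((sub_pole_isBigO hm ht hG).comp_tendsto htend).congr (fun y => ?_) fun y => ?_
  · simp only [Function.comp, div_eq_mul_inv]
  · simp only [Function.comp]
    rw [← Complex.ofReal_sub, Complex.norm_real, Real.norm_eq_abs]

lemma holder_comp_const_sub {ψ₀ : ℝ → ℂ} {x a α : ℝ}
    (h : (fun y : ℝ => ψ₀ y - ψ₀ (x - a)) =O[𝓝 (x - a)] fun y : ℝ => |y - (x - a)| ^ α) :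
    (fun y : ℝ => ψ₀ (x - y) - ψ₀ (x - a)) =O[𝓝 a] fun y : ℝ => |y - a| ^ α := by
  have htend : Tendsto (fun y : ℝ => x - y) (𝓝 a) (𝓝 (x - a)) :=
    (by fun_prop : Continuous fun y : ℝ => x - y).tendsto a
  refine (h.comp_tendsto htend).congr (fun y => rfl) fun y => ?_
  simp only [Function.comp]
  rw [sub_sub_sub_cancel_left, abs_sub_comm]

lemma exists_propagator_hasPrincipalValue {m : ℝ} (hm : 0 ≤ m) {t : ℝ} (ht : 0 < t) {G : ℂ → ℂ}
    (hG : Set.EqOn G (propagator m t) (contourRegion t)) {ψ₀ : ℝ → ℂ} (hψ : Continuous ψ₀)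
    (hψs : HasCompactSupport ψ₀) (x : ℝ) {α : ℝ} (hα : 0 < α)
    (h₁ : (fun y : ℝ => ψ₀ y - ψ₀ (x - t)) =O[𝓝 (x - t)] (fun y : ℝ => |y - (x - t)| ^ α))
    (h₂ : (fun y : ℝ => ψ₀ y - ψ₀ (x + t)) =O[𝓝 (x + t)] (fun y : ℝ => |y - (x + t)| ^ α)) :
    ∃ L : ℂ, HasPrincipalValue t (fun y : ℝ => G (y : ℂ) * ψ₀ (x - y)) L := by
  have hG' : Set.EqOn (fun z => G (-z)) (propagator m t) (contourRegion t) := fun z hz =>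
    (hG (neg_mem_contourRegion hz)).trans (propagator_neg m t z)
  rw [← sub_neg_eq_add] at h₂
  -- Reflecting an even function negates the residue, hence the sign of `c₂`.
  refine exists_hasPrincipalValue ht (g := fun y : ℝ => G y) (φ := fun y => ψ₀ (x - y))
    (c₁ := poleCoeff m t) (c₂ := -poleCoeff m t) ?_ (by fun_prop)
    (hψs.comp_homeomorph (Homeomorph.subLeft x)) hα (real_pole_isBigO hm ht hG) ?_
    (holder_comp_const_sub h₁) (holder_comp_const_sub h₂)
  · have hGc : ContinuousOn G (contourRegion t) :=
      (analyticOnNhd_propagator hm t).continuousOn.congr hG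
    exact hGc.comp Complex.continuous_ofReal.continuousOn
      fun y hy => ofReal_mem_contourRegion hy.1 hy.2
  · have htend : Tendsto (fun y : ℝ => -y) (𝓝[≠] (-t)) (𝓝[≠] t) := by
      refine tendsto_nhdsWithin_iff.2 ⟨?_, ?_⟩
      · have h := ((continuous_neg (G := ℝ)).tendsto (-t)).mono_left
          (nhdsWithin_le_nhds (s := {-t}ᶜ))
        simpa using h
      · filter_upwards [self_mem_nhdsWithin] with y hy h
        exact hy (by rw [← (show -y = t from h), neg_neg]; rfl)
    refine ((real_pole_isBigO hm ht hG').comp_tendsto htend).congr (fun y => ?_) fun y => ?_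
    · simp only [Function.comp, Complex.ofReal_neg, neg_neg]
      rw [show (-(y : ℂ) - t) = -(y - -t) by ring, inv_neg]
      ring
    · simp only [Function.comp]
      rw [show -y - t = -(y - -t) by ring, abs_neg]

end Salpeter

end

theorem mainTheorem8 (m t : ℝ) (hm : 0 ≤ m) (ht : 0 < t) :
    (∃ G : ℂ → ℂ, Salpeter.IsPropagatorContinuation m t G ∧
      ∀ G' : ℂ → ℂ, Salpeter.IsPropagatorContinuation m t G' →
        Set.EqOn G' G (Salpeter.contourRegion t)) ∧
    ∀ G : ℂ → ℂ, Salpeter.IsPropagatorContinuation m t G →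
      ∀ (ψ₀ : ℝ → ℂ) (Ψ : ℂ → ℂ), Continuous ψ₀ → HasCompactSupport ψ₀ →
        Salpeter.IsComplexExtension ψ₀ Ψ → ∀ x : ℝ,
        (∀ L : ℂ,
          Salpeter.HasPrincipalValue t (fun y : ℝ => G (y : ℂ) * ψ₀ (x - y)) L ↔
          Salpeter.HasContourIntegral t (fun z : ℂ => G z * Ψ ((x : ℂ) - z))
            (L + 1 / 2 * ψ₀ (x - t) * Complex.exp (Complex.I * m * t)
               + 1 / 2 * ψ₀ (x + t) * Complex.exp (Complex.I * m * t))) ∧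
        ((∃ α : ℝ, 0 < α ∧
            (fun y : ℝ => ψ₀ y - ψ₀ (x - t)) =O[𝓝 (x - t)] (fun y : ℝ => |y - (x - t)| ^ α) ∧
            (fun y : ℝ => ψ₀ y - ψ₀ (x + t)) =O[𝓝 (x + t)] (fun y : ℝ => |y - (x + t)| ^ α)) →
          ∃ L : ℂ,
            Salpeter.HasPrincipalValue t (fun y : ℝ => G (y : ℂ) * ψ₀ (x - y)) L ∧
            Salpeter.HasContourIntegral t (fun z : ℂ => G z * Ψ ((x : ℂ) - z))
              (L + 1 / 2 * ψ₀ (x - t) * Complex.exp (Complex.I * m * t)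
                 + 1 / 2 * ψ₀ (x + t) * Complex.exp (Complex.I * m * t))) := by
  have hP := Salpeter.isPropagatorContinuation_propagator hm t
  refine ⟨⟨Salpeter.propagator m t, hP, fun G' hG' => hG'.eqOn ht hP⟩, ?_⟩
  intro G hG ψ₀ Ψ hψ hψs hΨ x
  have hE := hG.eqOn ht hP
  have hiff := Salpeter.hasPrincipalValue_iff_hasContourIntegral hm ht hE hΨ x
  refine ⟨hiff, ?_⟩
  rintro ⟨α, hα, h₁, h₂⟩
  obtain ⟨L, hL⟩ := Salpeter.exists_propagator_hasPrincipalValue hm ht hE hψ hψs x hα h₁ h₂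
  exact ⟨L, hL, (hiff L).1 hL⟩
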